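/- **Theorem 1.1.** Let $d\ge 1$ be an integer and let $\mathcal M$ be a small, projectively generated $d$-abelian category. Let $\mathcal P$ be the full subcategory of projective objects of $\mathcal M$, let $\operatorname{mod}\mathcal P$ be the category of finitely presented contravariant functors from $\mathcal P$ to abelian groups, and let $F\colon\mathcal M\to\operatorname{mod}\mathcal P$ be the functor $F(X)=\mathcal M(-,X)|_{\mathcal P}$. Then $\operatorname{mod}\mathcal P$ is an abelian category, and the essential image $$F\mathcal M=\{G\in\operatorname{mod}\mathcal P \mid \exists X\in\mathcal M:\ F(X)\cong G\}$$ is a $d$-cluster tilting subcategory of $\operatorname{mod}\mathcal P$. Here the following terminology is used. * Let $\mathcal M$ be an additive category. A *$d$-cokernel* of a morphism $f^0\colon X^0\to X^1$ is a sequence $X^1\xrightarrow{f^1}X^2\to\cdots\xrightarrow{f^d}X^{d+1}$ such that $0\to\mathcal M(X^{d+1},Z)\to\mathcal M(X^d,Z)\to\cdots\to\mathcal M(X^1,Z)\to\mathcal M(X^0,Z)$ is exact for all $Z\in\mathcal M$; a *$d$-kernel* of a morphism $X^d\to X^{d+1}$ is defined dually. A sequence $X^0\xrightarrow{f^0}\cdots\xrightarrow{f^d}X^{d+1}$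 is *$d$-exact* if $(f^0,\dots,f^{d-1})$ is a $d$-kernel of $f^d$ and $(f^1,\dots,f^d)$ is a $d$-cokernel of $f^0$. * An additive category $\mathcal M$ is *$d$-abelian* if it is idempotent complete, every morphism has a $d$-kernel and a $d$-cokernel, every monomorphism together with any $d$-cokernel of it forms a $d$-exact sequence, and every epimorphism together with any $d$-kernel of it forms a $d$-exact sequence. * An object $P$ of $\mathcal M$ is *projective* if $\mathcal M(P,X)\to\mathcal M(P,Y)$ is surjective for every epimorphism $X\to Y$; $\mathcal M$ is *projectively generated* if for every object $X$ there is an epimorphism $P\to X$ with $P$ projective. * A contravariant functor $G$ from $\mathcal P$ to abelian groups is *finitely presented* if there is an exact sequence $\mathcal P(-,P_1)\to\mathcal P(-,P_0)\to G\to 0$ with $P_0,P_1\in\mathcal P$. * A full subcategory $\mathcal T$ of an abelian category $\mathcal A$ is *$d$-cluster tilting* if it is contravariantly finite (every object has a right $\mathcal T$-approximation), covariantly finite (every object has a left $\mathcal T$-approximation), generating (every object is a quotient of an object of $\mathcal T$), cogenerating (every object is a subobject of an object of $\mathcal T$), and $$\mathcal T=\{X\in\mathcal A\mid \operatorname{Ext}^i_{\mathcal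 A}(X,\mathcal T)=0\text{ for }1\le i\le d-1\}=\{X\in\mathcal A\mid \operatorname{Ext}^i_{\mathcal A}(\mathcal T,X)=0\text{ for }1\le i\le d-1\}.$$ -/

import Mathlib

open CategoryTheory CategoryTheory.Limits Opposite

universe v u

namespace HigherAbelian

section DAbelian

variable {M : Type u} [Category.{v} M] [Preadditive M] {d : ℕ}

/-- For a sequence `X⁰ ⟶ X¹ ⟶ ⋯ ⟶ X^{d+1}` with maps `f⁰, …, f^d`, the tuple `(f¹, …, f^d)` is a
`d`-cokernel of `f⁰`: for every `Z` the sequence of abelian groups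
`0 ⟶ M(X^{d+1}, Z) ⟶ M(X^d, Z) ⟶ ⋯ ⟶ M(X¹, Z) ⟶ M(X⁰, Z)` is exact. -/
structure IsDCokernel (S : ComposableArrows M (d + 1)) : Prop where
  injective : ∀ Z : M, Function.Injective
    (fun h : S.obj' (d + 1) ⟶ Z => S.map' d (d + 1) ≫ h)
  exact : ∀ (Z : M) (i : ℕ) (hi : i < d), Function.Exact
    (fun h : S.obj' (i + 2) ⟶ Z => S.map' (i + 1) (i + 2) ≫ h)
    (fun h : S.obj' (i + 1) ⟶ Z => S.map' i (i + 1) ≫ h)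

/-- For a sequence `Y⁰ ⟶ Y¹ ⟶ ⋯ ⟶ Y^{d+1}` with maps `g⁰, …, g^d`, the tuple `(g⁰, …, g^{d-1})`
is a `d`-kernel of `g^d`: for every `Z` the sequence of abelian groups
`0 ⟶ M(Z, Y⁰) ⟶ M(Z, Y¹) ⟶ ⋯ ⟶ M(Z, Y^d) ⟶ M(Z, Y^{d+1})` is exact. -/
structure IsDKernel (S : ComposableArrows M (d + 1)) : Prop where
  injective : ∀ Z : M, Function.Injective
    (fun h : Z ⟶ S.obj' 0 => h ≫ S.map' 0 1)
  exact : ∀ (Z : M) (i : ℕ) (hi : i < d), Function.Exact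
    (fun h : Z ⟶ S.obj' i => h ≫ S.map' i (i + 1))
    (fun h : Z ⟶ S.obj' (i + 1) => h ≫ S.map' (i + 1) (i + 2))

/-- A `d`-exact sequence `X⁰ ⟶ X¹ ⟶ ⋯ ⟶ X^{d+1}`. -/
structure IsDExact (S : ComposableArrows M (d + 1)) : Prop where
  isDKernel : IsDKernel S
  isDCokernel : IsDCokernel S

/-- The category `M` is `d`-abelian. (The zero object and the binary biproducts of an additive
category are contained in `HasFiniteBiproducts`.) -/
structure IsDAbelian (d : ℕ) (M : Type u) [Category.{v} M] [Preadditive M] : Prop where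
  hasFiniteBiproducts : HasFiniteBiproducts M
  isIdempotentComplete : IsIdempotentComplete M
  exists_dKernel : ∀ {A B : M} (f : A ⟶ B), ∃ S : ComposableArrows M (d + 1),
    Arrow.mk (S.map' d (d + 1)) = Arrow.mk f ∧ IsDKernel S
  exists_dCokernel : ∀ {A B : M} (f : A ⟶ B), ∃ S : ComposableArrows M (d + 1),
    Arrow.mk (S.map' 0 1) = Arrow.mk f ∧ IsDCokernel S
  isDExact_of_mono : ∀ S : ComposableArrows M (d + 1),
    Mono (S.map' 0 1) → IsDCokernel S → IsDExact S
  isDExact_of_epi : ∀ S : ComposableArrows M (d + 1),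
    Epi (S.map' d (d + 1)) → IsDKernel S → IsDExact S

end DAbelian

section Modules

/-- Finitely presented contravariant functors `G` from `P` to abelian groups: there is a
morphism `f : P₁ ⟶ P₀` in `P` and an exact sequence `P(-, P₁) ⟶ P(-, P₀) ⟶ G ⟶ 0`.
Such a functor is automatically additive. -/
def finitelyPresented (P : Type u) [Category.{v} P] [Preadditive P] :
    ObjectProperty (Pᵒᵖ ⥤ AddCommGrpCat.{v}) := fun G =>
  ∃ (P₁ P₀ : P) (f : P₁ ⟶ P₀) (g : preadditiveYoneda.obj P₀ ⟶ G), ∀ Q : Pᵒᵖ,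
    Function.Exact ((preadditiveYoneda.map f).app Q) (g.app Q) ∧
      Function.Surjective (g.app Q)

/-- The category `mod P`, with all natural transformations as morphisms. -/
abbrev FPMod (P : Type u) [Category.{v} P] [Preadditive P] :=
  (finitelyPresented P).FullSubcategory

variable (M : Type u) [Category.{v} M] [Preadditive M]

/-- The full subcategory of projective objects of `M`. -/
abbrev Proj := (isProjective M).FullSubcategory

/-- The functor `X ↦ M(-, X)` restricted to the projective objects, with values in all
contravariant functors to abelian groups. -/
def restrictedYoneda : M ⥤ (Proj M)ᵒᵖ ⥤ AddCommGrpCat.{v} :=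
  preadditiveYoneda ⋙ (Functor.whiskeringLeft _ _ _).obj (isProjective M).ι.op

variable {M}

/-- In a projectively generated `d`-abelian category, `M(-, X)` restricted to the projective
objects is finitely presented. -/
theorem finitelyPresented_restrictedYoneda {d : ℕ} (hd : 1 ≤ d) (hM : IsDAbelian d M)
    [EnoughProjectives M] (X : M) :
    finitelyPresented (Proj M) ((restrictedYoneda M).obj X) := by
  obtain ⟨e, rfl⟩ : ∃ e, d = e + 1 := ⟨d - 1, by omega⟩
  have key : ∀ {A B : M} (f : A ⟶ B), ∃ (K : M) (k : K ⟶ A), ∀ Z : M, Function.Exact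
      (fun h : Z ⟶ K => h ≫ k) (fun h : Z ⟶ A => h ≫ f) := by
    intro A B f
    obtain ⟨S, hS, hk⟩ := hM.exists_dKernel f
    cases hS
    exact ⟨_, _, fun Z => hk.exact Z e (by omega)⟩
  obtain ⟨K, k, hk⟩ := key (Projective.π X)
  let P₁ : Proj M := ⟨Projective.over K, Projective.projective_over K⟩
  let P₀ : Proj M := ⟨Projective.over X, Projective.projective_over X⟩
  let f : P₁ ⟶ P₀ := ObjectProperty.homMk (Projective.π K ≫ k)
  let g : preadditiveYoneda.obj P₀ ⟶ (restrictedYoneda M).obj X :=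
    { app := fun Q => AddCommGrpCat.ofHom
        { toFun := fun h => ((h : Q.unop ⟶ P₀).hom ≫ Projective.π X : Q.unop.obj ⟶ X)
          map_zero' := zero_comp
          map_add' := fun _ _ => Preadditive.add_comp _ _ _ _ _ _ }
      naturality := fun _ _ q => AddCommGrpCat.ext fun h => Category.assoc _ _ _ }
  refine ⟨P₁, P₀, f, g, fun Q => ⟨fun h => ?_, fun h => ?_⟩⟩
  · have : Projective Q.unop.obj := Q.unop.property
    refine (hk Q.unop.obj (h : Q.unop ⟶ P₀).hom).trans ⟨?_, ?_⟩
    · rintro ⟨t, ht⟩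
      refine ⟨(ObjectProperty.homMk (Projective.factorThru t (Projective.π K)) :
        Q.unop ⟶ P₁), ?_⟩
      apply ObjectProperty.hom_ext
      change Projective.factorThru t (Projective.π K) ≫ Projective.π K ≫ k =
        (h : Q.unop ⟶ P₀).hom
      rw [Projective.factorThru_comp_assoc]
      exact ht
    · rintro ⟨t, ht⟩
      refine ⟨(t : Q.unop ⟶ P₁).hom ≫ Projective.π K, ?_⟩
      rw [← ht]
      exact Category.assoc _ _ _
  · have : Projective Q.unop.obj := Q.unop.property
    exact ⟨(ObjectProperty.homMk (Projective.factorThru (h : Q.unop.obj ⟶ X)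
      (Projective.π X)) : Q.unop ⟶ P₀), Projective.factorThru_comp _ _⟩

/-- The functor `F : M ⥤ mod P`, `F(X) = M(-, X)|_P`, where `P` is the category of projective
objects of the projectively generated `d`-abelian category `M`. -/
def toFPMod {d : ℕ} (hd : 1 ≤ d) (hM : IsDAbelian d M) [EnoughProjectives M] :
    M ⥤ FPMod (Proj M) :=
  (finitelyPresented (Proj M)).lift (restrictedYoneda M)
    (finitelyPresented_restrictedYoneda hd hM)

end Modules

section ClusterTilting

variable {A : Type u} [Category.{v} A]

/-- Every object of `A` has a right `T`-approximation. -/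
def IsContravariantlyFinite (T : ObjectProperty A) : Prop :=
  ∀ G : A, ∃ (X : A) (p : X ⟶ G), T X ∧
    ∀ (Y : A), T Y → ∀ ψ : Y ⟶ G, ∃ q : Y ⟶ X, q ≫ p = ψ

/-- Every object of `A` has a left `T`-approximation. -/
def IsCovariantlyFinite (T : ObjectProperty A) : Prop :=
  ∀ G : A, ∃ (X : A) (j : G ⟶ X), T X ∧
    ∀ (Y : A), T Y → ∀ ψ : G ⟶ Y, ∃ q : X ⟶ Y, j ≫ q = ψ

/-- Every object of `A` is a quotient of an object of `T`. -/
def IsGenerating (T : ObjectProperty A) : Prop :=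
  ∀ G : A, ∃ (X : A) (p : X ⟶ G), T X ∧ Epi p

/-- Every object of `A` is a subobject of an object of `T`. -/
def IsCogenerating (T : ObjectProperty A) : Prop :=
  ∀ G : A, ∃ (X : A) (j : G ⟶ X), T X ∧ Mono j

variable [Abelian A]

/-- `Extⁱ_A(X, Y) = 0`. -/
def ExtVanishes (X Y : A) (i : ℕ) : Prop :=
  haveI : HasExt.{max u v} A := HasExt.standard A
  Subsingleton (Abelian.Ext.{max u v} X Y i)

/-- The full subcategory of the abelian category `A` on the objects satisfying `T` is
`d`-cluster tilting. -/
structure IsClusterTilting (d : ℕ) (T : ObjectProperty A) : Prop where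
  isContravariantlyFinite : IsContravariantlyFinite T
  isCovariantlyFinite : IsCovariantlyFinite T
  isGenerating : IsGenerating T
  isCogenerating : IsCogenerating T
  iff_ext_left : ∀ X : A, T X ↔
    ∀ i : ℕ, 1 ≤ i → i < d → ∀ Y : A, T Y → ExtVanishes X Y i
  iff_ext_right : ∀ X : A, T X ↔
    ∀ i : ℕ, 1 ≤ i → i < d → ∀ Y : A, T Y → ExtVanishes Y X i

end ClusterTilting

end HigherAbelian

/-! The argument splits into a criterion inside an arbitrary abelian category and the verification
of its hypotheses for `F`.

Criterion (`isClusterTilting_of_isRigid`). Let `T` contain zero and be closed under retracts and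
binary sums. It is `d`-cluster tilting if it is rigid in degrees `1, …, d - 1`, cokernels of
monomorphisms inside `T` have `d`-term coresolutions, kernels of epimorphisms inside `T` have
`d`-term resolutions, and every object has some finite resolution by `T`. A finite resolution is
converted into a `d`-term coresolution by induction on its length, using the horseshoe construction
(`HasResolution.hasCoresolution`); duality then gives a `d`-term resolution of every object. By
dimension shifting, the first steps of these are approximations. If `G` is orthogonal to `T`, its
(co)resolution splits inductively, so `G` is a retract of an object of `T`.

Verification. Weak kernels among the projectives make finitely presented functors closed under
kernels and cokernels, so `mod P` is abelian with pointwise exactness. Evaluation at projectives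
then shows that `F` sends `d`-kernels to exact sequences. Since an epimorphism of `M` is a cokernel
of each of its weak kernels, `F` is fully faithful. The axioms on monomorphisms and epimorphisms
give the required (co)resolutions. For rigidity, the `d`-kernel of an epimorphism from a projective
onto `X` is also part of a `d`-cokernel; hence its image under `F` is a resolution on which `Hom(-,
F Y)` is exact, and this forces `Ext` to vanish (`isRigid_of_hasExactResolution`). -/

namespace HigherAbelian

universe w

/-! ### Finite resolutions and coresolutions, and passing from one to the other -/

section Resolutions

open scoped ZeroObject

variable {A : Type u} [Category.{v} A] [Abelian A]

/-- `G` has a coresolution `0 ⟶ G ⟶ Z₁ ⟶ ⋯ ⟶ Zₙ ⟶ 0` by `n` objects satisfying `T`. -/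
def HasCoresolution (T : ObjectProperty A) : ℕ → A → Prop
  | 0, G => IsZero G
  | n + 1, G => ∃ (Z C : A) (i : G ⟶ Z) (p : Z ⟶ C) (w : i ≫ p = 0),
      (ShortComplex.mk i p w).ShortExact ∧ T Z ∧ HasCoresolution T n C

/-- `G` has a resolution `0 ⟶ Zₙ ⟶ ⋯ ⟶ Z₁ ⟶ G ⟶ 0` by `n` objects satisfying `T`. -/
def HasResolution (T : ObjectProperty A) : ℕ → A → Prop
  | 0, G => IsZero G
  | n + 1, G => ∃ (K Z : A) (i : K ⟶ Z) (p : Z ⟶ G) (w : i ≫ p = 0),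
      (ShortComplex.mk i p w).ShortExact ∧ T Z ∧ HasResolution T n K

theorem shortExact_kernel {X Y : A} (f : X ⟶ Y) [Epi f] :
    (ShortComplex.mk (kernel.ι f) f (kernel.condition f)).ShortExact :=
  .mk' (ShortComplex.exact_of_f_is_kernel _ (kernelIsKernel f)) inferInstance ‹_›

theorem shortExact_cokernel {X Y : A} (f : X ⟶ Y) [Mono f] :
    (ShortComplex.mk f (cokernel.π f) (cokernel.condition f)).ShortExact :=
  .mk' (ShortComplex.exact_of_g_is_cokernel _ (cokernelIsCokernel f)) ‹_› inferInstance

theorem hasCoresolution_iff_hasResolution_op (T : ObjectProperty A) (n : ℕ) (G : A) :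
    HasCoresolution T n G ↔ HasResolution T.op n (op G) := by
  induction n generalizing G with
  | zero => exact ⟨fun h => h.op, fun h => h.unop⟩
  | succ n ih =>
    constructor
    · rintro ⟨Z, C, i, p, w, hS, hZ, hC⟩
      exact ⟨op C, op Z, p.op, i.op, by rw [← op_comp, w, op_zero], hS.op, hZ, (ih C).1 hC⟩
    · rintro ⟨K, Z, i, p, w, hS, hZ, hK⟩
      exact ⟨Z.unop, K.unop, p.unop, i.unop, by rw [← unop_comp, w, unop_zero], hS.unop, hZ,
        (ih K.unop).2 hK⟩

theorem hasResolution_iff_hasCoresolution_op (T : ObjectProperty A) (n : ℕ) (G : A) :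
    HasResolution T n G ↔ HasCoresolution T.op n (op G) := by
  induction n generalizing G with
  | zero => exact ⟨fun h => h.op, fun h => h.unop⟩
  | succ n ih =>
    constructor
    · rintro ⟨K, Z, i, p, w, hS, hZ, hK⟩
      exact ⟨op Z, op K, p.op, i.op, by rw [← op_comp, w, op_zero], hS.op, hZ, (ih K).1 hK⟩
    · rintro ⟨Z, C, i, p, w, hS, hZ, hC⟩
      exact ⟨C.unop, Z.unop, p.unop, i.unop, by rw [← unop_comp, w, unop_zero], hS.unop, hZ,
        (ih C.unop).2 hC⟩

theorem HasCoresolution.of_iso {T : ObjectProperty A} {n : ℕ} {G H : A}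
    (h : HasCoresolution T n G) (e : G ≅ H) : HasCoresolution T n H := by
  cases n with
  | zero => exact IsZero.of_iso h e.symm
  | succ n =>
    obtain ⟨Z, C, i, p, w, hS, hZ, hC⟩ := h
    have w' : (e.inv ≫ i) ≫ p = 0 := by simp [w]
    let φ : ShortComplex.mk i p w ≅ ShortComplex.mk (e.inv ≫ i) p w' :=
      ShortComplex.isoMk e (Iso.refl _) (Iso.refl _) (by simp) (by simp)
    exact ⟨Z, C, e.inv ≫ i, p, w', ShortComplex.shortExact_of_iso φ hS, hZ, hC⟩

theorem HasResolution.of_iso {T : ObjectProperty A} {n : ℕ} {G H : A}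
    (h : HasResolution T n G) (e : G ≅ H) : HasResolution T n H :=
  (hasResolution_iff_hasCoresolution_op T n H).2
    (((hasResolution_iff_hasCoresolution_op T n G).1 h).of_iso e.symm.op)

theorem HasCoresolution.succ {T : ObjectProperty A} (hT : T 0) {n : ℕ} {G : A}
    (h : HasCoresolution T n G) : HasCoresolution T (n + 1) G := by
  induction n generalizing G with
  | zero =>
    refine ⟨0, 0, 0, 0, by simp, ?_, hT, isZero_zero A⟩
    have : Mono (0 : G ⟶ 0) := ⟨fun _ _ _ => h.eq_of_tgt _ _⟩
    exact .mk' (ShortComplex.exact_of_isZero_X₂ _ (isZero_zero A)) this inferInstance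
  | succ n ih =>
    obtain ⟨Z, C, i, p, w, hS, hZ, hC⟩ := h
    exact ⟨Z, C, i, p, w, hS, hZ, ih hC⟩

/-- Truncated subtraction covers `n = 0` uniformly: a zero object embeds in the zero object with
zero cokernel. -/
theorem HasCoresolution.exists_mono {T : ObjectProperty A} (hT : T 0) {n : ℕ} {G : A}
    (h : HasCoresolution T n G) :
    ∃ (Z C : A) (i : G ⟶ Z) (p : Z ⟶ C) (w : i ≫ p = 0),
      (ShortComplex.mk i p w).ShortExact ∧ T Z ∧ HasCoresolution T (n - 1) C := by
  cases n with
  | zero => exact h.succ hT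
  | succ n => exact h

/-- The cokernels of the middle column in the horseshoe construction. -/
theorem exists_shortExact_biprod {A₁ A₂ A₃ B₁ B₃ C₁ C₃ : A}
    {i : A₁ ⟶ A₂} {p : A₂ ⟶ A₃} {w : i ≫ p = 0} (h : (ShortComplex.mk i p w).ShortExact)
    {a₁ : A₁ ⟶ B₁} {c₁ : B₁ ⟶ C₁} {w₁ : a₁ ≫ c₁ = 0} (h₁ : (ShortComplex.mk a₁ c₁ w₁).ShortExact)
    {a₃ : A₃ ⟶ B₃} {c₃ : B₃ ⟶ C₃} {w₃ : a₃ ≫ c₃ = 0} (h₃ : (ShortComplex.mk a₃ c₃ w₃).ShortExact)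
    (e : A₂ ⟶ B₁) (he : i ≫ e = a₁) :
    ∃ (C₂ : A) (c : B₁ ⊞ B₃ ⟶ C₂) (w' : biprod.lift e (p ≫ a₃) ≫ c = 0)
      (s : C₁ ⟶ C₂) (t : C₂ ⟶ C₃) (w'' : s ≫ t = 0),
      (ShortComplex.mk _ c w').ShortExact ∧ (ShortComplex.mk s t w'').ShortExact := by
  have : Mono i := h.mono_f
  have : Epi p := h.epi_g
  have : Mono a₁ := h₁.mono_f
  have : Epi c₁ := h₁.epi_g
  have : Mono a₃ := h₃.mono_f
  have : Epi c₃ := h₃.epi_g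
  set m := biprod.lift e (p ≫ a₃) with hm
  have him : i ≫ m = a₁ ≫ biprod.inl := by
    apply biprod.hom_ext <;> simp [hm, he, reassoc_of% w]
  -- A generalized element of `A₂` whose image in `B₃` vanishes comes from `A₁`, because `a₃` is
  -- mono.
  have key : ∀ {X : A} (z : X ⟶ A₂), z ≫ m ≫ biprod.snd = 0 → ∃ y, y ≫ i = z := by
    intro X z hz
    have hz' : (z ≫ p) ≫ a₃ = 0 := by simpa [hm] using hz
    exact ⟨h.exact.lift z (zero_of_comp_mono _ hz'), h.exact.lift_f _ _⟩
  have hmono : Mono m := by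
    refine Preadditive.mono_of_cancel_zero _ fun z hz => ?_
    obtain ⟨y, rfl⟩ := key z (by rw [reassoc_of% hz, zero_comp])
    have : (y ≫ a₁) ≫ (biprod.inl : B₁ ⟶ B₁ ⊞ B₃) = 0 := by simpa [him] using hz
    rw [zero_of_comp_mono a₁ (zero_of_comp_mono _ this), zero_comp]
  have ws : a₁ ≫ biprod.inl ≫ cokernel.π m = 0 := by
    rw [← reassoc_of% him, cokernel.condition, comp_zero]
  have wt : m ≫ biprod.snd ≫ c₃ = 0 := by simp [hm, w₃]
  let s : C₁ ⟶ cokernel m := h₁.exact.desc (biprod.inl ≫ cokernel.π m) ws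
  have hs : c₁ ≫ s = biprod.inl ≫ cokernel.π m := h₁.exact.g_desc _ ws
  let t : cokernel m ⟶ C₃ := cokernel.desc m (biprod.snd ≫ c₃) wt
  have ht : cokernel.π m ≫ t = biprod.snd ≫ c₃ := cokernel.π_desc _ _ _
  have hst : s ≫ t = 0 := by
    rw [← cancel_epi c₁, reassoc_of% hs, ht]
    simp
  have hmc := (shortExact_cokernel m).exact
  rw [ShortComplex.exact_iff_exact_up_to_refinements] at hmc
  refine ⟨cokernel m, cokernel.π m, cokernel.condition m, s, t, hst, shortExact_cokernel m, ?_⟩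
  refine .mk' ?_ ?_ ?_
  · rw [ShortComplex.exact_iff_exact_up_to_refinements]
    intro X x hx
    dsimp at x hx ⊢
    obtain ⟨X', π, _, y, hy⟩ := surjective_up_to_refinements_of_epi (cokernel.π m) x
    have hy3 : (y ≫ biprod.snd) ≫ c₃ = 0 := by
      rw [Category.assoc, ← ht, ← reassoc_of% hy, hx, comp_zero]
    obtain ⟨X'', π', _, z, hz⟩ := surjective_up_to_refinements_of_epi p (h₃.exact.lift _ hy3)
    have hz' : π' ≫ y ≫ biprod.snd = z ≫ p ≫ a₃ := by
      rw [← reassoc_of% hz]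
      congr 1
      exact (h₃.exact.lift_f _ hy3).symm
    refine ⟨X'', π' ≫ π, inferInstance, (π' ≫ y - z ≫ m) ≫ biprod.fst ≫ c₁, ?_⟩
    -- Subtracting `z ≫ m` cancels the `B₃`-coordinate of `y` without changing its class in the
    -- cokernel, so that class comes from `B₁`.
    have hd : (π' ≫ y - z ≫ m) = ((π' ≫ y - z ≫ m) ≫ biprod.fst) ≫ biprod.inl := by
      apply biprod.hom_ext
      · simp
      · simp [hm, hz']
    simp only [Category.assoc]
    rw [hs, hy]
    rw [← Category.assoc, ← Category.assoc, ← Category.assoc, ← hd]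
    simp
  · refine Preadditive.mono_of_cancel_zero _ fun {X} x hx => ?_
    dsimp at x hx
    obtain ⟨X', π, _, y, hy⟩ := surjective_up_to_refinements_of_epi c₁ x
    obtain ⟨X'', π', _, z, hz⟩ := hmc (y ≫ biprod.inl)
      (by dsimp; rw [Category.assoc, ← hs, ← reassoc_of% hy, hx, comp_zero])
    dsimp at z hz
    obtain ⟨r, rfl⟩ := key z (by rw [← reassoc_of% hz]; simp)
    have : (π' ≫ y - r ≫ a₁) ≫ (biprod.inl : B₁ ⟶ B₁ ⊞ B₃) = 0 := by
      simp [hz, him]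
    have h2 := sub_eq_zero.1 (zero_of_comp_mono _ this)
    rw [← cancel_epi π, ← cancel_epi π', hy, reassoc_of% h2, w₁]
    simp
  · have : Epi (cokernel.π m ≫ t) := by rw [ht]; infer_instance
    exact epi_of_epi (cokernel.π m) t

/-- The third isomorphism theorem in terms of short exact sequences. -/
theorem exists_shortExact_comp {G G' C W W' : A}
    {i : G ⟶ G'} {p : G' ⟶ C} {w : i ≫ p = 0} (h : (ShortComplex.mk i p w).ShortExact)
    {j : G' ⟶ W} {q : W ⟶ W'} {w' : j ≫ q = 0} (h' : (ShortComplex.mk j q w').ShortExact) :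
    ∃ (H : A) (c : W ⟶ H) (w₁ : (i ≫ j) ≫ c = 0) (s : C ⟶ H) (t : H ⟶ W') (w₂ : s ≫ t = 0),
      (ShortComplex.mk _ c w₁).ShortExact ∧ (ShortComplex.mk s t w₂).ShortExact := by
  have : Mono i := h.mono_f
  have : Epi p := h.epi_g
  have : Mono j := h'.mono_f
  have : Epi q := h'.epi_g
  have ws : i ≫ j ≫ cokernel.π (i ≫ j) = 0 := by
    rw [← Category.assoc, cokernel.condition]
  have wt : (i ≫ j) ≫ q = 0 := by rw [Category.assoc, w', comp_zero]
  let s : C ⟶ cokernel (i ≫ j) := h.exact.desc (j ≫ cokernel.π (i ≫ j)) ws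
  have hs : p ≫ s = j ≫ cokernel.π (i ≫ j) := h.exact.g_desc _ ws
  let t : cokernel (i ≫ j) ⟶ W' := cokernel.desc _ q wt
  have ht : cokernel.π (i ≫ j) ≫ t = q := cokernel.π_desc _ _ _
  have hst : s ≫ t = 0 := by
    rw [← cancel_epi p, reassoc_of% hs, ht, w', comp_zero]
  have hmc := (shortExact_cokernel (i ≫ j)).exact
  rw [ShortComplex.exact_iff_exact_up_to_refinements] at hmc
  refine ⟨_, _, cokernel.condition (i ≫ j), s, t, hst, shortExact_cokernel _, .mk' ?_ ?_ ?_⟩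
  · rw [ShortComplex.exact_iff_exact_up_to_refinements]
    intro X x hx
    dsimp at x hx ⊢
    obtain ⟨X', π, _, y, hy⟩ := surjective_up_to_refinements_of_epi (cokernel.π (i ≫ j)) x
    have hyq : y ≫ q = 0 := by rw [← ht, ← reassoc_of% hy, hx, comp_zero]
    refine ⟨X', π, inferInstance, h'.exact.lift y hyq ≫ p, ?_⟩
    rw [hy, Category.assoc, hs, ← Category.assoc]
    congr 1
    exact (h'.exact.lift_f y hyq).symm
  · refine Preadditive.mono_of_cancel_zero _ fun {X} x hx => ?_
    dsimp at x hx
    obtain ⟨X', π, _, y, hy⟩ := surjective_up_to_refinements_of_epi p x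
    obtain ⟨X'', π', _, z, hz⟩ := hmc (y ≫ j)
      (by dsimp; rw [Category.assoc, ← hs, ← reassoc_of% hy, hx, comp_zero])
    dsimp at z hz
    have h2 : π' ≫ y = z ≫ i := by
      rw [← cancel_mono j]
      simpa using hz
    rw [← cancel_epi π, ← cancel_epi π', hy, reassoc_of% h2, w]
    simp
  · have : Epi (cokernel.π (i ≫ j) ≫ t) := by rw [ht]; infer_instance
    exact epi_of_epi (cokernel.π (i ≫ j)) t

/-- Morphisms to objects satisfying `T` extend along every monomorphism whose cokernel has an
`n`-term coresolution. -/
def ExtendsAlong (T : ObjectProperty A) (n : ℕ) : Prop :=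
  ∀ S : ShortComplex A, S.ShortExact → HasCoresolution T n S.X₃ →
    ∀ Y : A, T Y → ∀ f : S.X₁ ⟶ Y, ∃ g : S.X₂ ⟶ Y, S.f ≫ g = f

theorem ExtendsAlong.of_succ {T : ObjectProperty A} (hT : T 0) {n : ℕ}
    (h : ExtendsAlong T (n + 1)) : ExtendsAlong T n :=
  fun S hS hn => h S hS (hn.succ hT)

/-- The horseshoe lemma for coresolutions. -/
theorem HasCoresolution.extension {T : ObjectProperty A} (hT : T 0)
    (hsum : ∀ X Y, T X → T Y → T (X ⊞ Y)) {n : ℕ} (hext : ExtendsAlong T n)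
    {C H W : A} {i : C ⟶ H} {p : H ⟶ W} {w : i ≫ p = 0} (h : (ShortComplex.mk i p w).ShortExact)
    (hC : HasCoresolution T n C) (hW : HasCoresolution T n W) : HasCoresolution T n H := by
  induction n generalizing C H W with
  | zero =>
    have hH : IsZero H := ShortComplex.Exact.isZero_of_both_zeros h.exact
      (IsZero.eq_of_src hC _ _) (IsZero.eq_of_tgt hW _ _)
    exact hH
  | succ n ih =>
    obtain ⟨V, C', a₁, c₁, w₁, h₁, hV, hC'⟩ := id hC
    obtain ⟨U, W', a₃, c₃, w₃, h₃, hU, hW'⟩ := id hW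
    obtain ⟨e, he⟩ := hext _ h hW V hV a₁
    obtain ⟨H', c, w', s, t, w'', hS, hS'⟩ := exists_shortExact_biprod h h₁ h₃ e he
    exact ⟨V ⊞ U, H', _, c, w', hS, hsum _ _ hV hU, ih (hext.of_succ hT) hS' hC' hW'⟩

/-- If `T` has enough extensions of morphisms and cokernels of monomorphisms in `T` have
`(e + 1)`-term coresolutions, then so does every object with a finite resolution. -/
theorem HasResolution.hasCoresolution {T : ObjectProperty A} (hT : T 0)
    (hsum : ∀ X Y, T X → T Y → T (X ⊞ Y)) {e : ℕ} (hext : ExtendsAlong T e)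
    (hmono : ∀ S : ShortComplex A, S.ShortExact → T S.X₁ → T S.X₂ →
      HasCoresolution T (e + 1) S.X₃)
    {n : ℕ} {G : A} (hG : HasResolution T n G) : HasCoresolution T (e + 1) G := by
  induction n generalizing G with
  | zero =>
    have : ∀ k, HasCoresolution T k G := fun k => by
      induction k with
      | zero => exact hG
      | succ k ih => exact ih.succ hT
    exact this _
  | succ n ih =>
    obtain ⟨K, T₀, k, q, wk, hk, hT₀, hK⟩ := hG
    obtain ⟨Z₀, C, i, p, w, hS, hZ₀, hC⟩ := ih hK
    obtain ⟨Z₁, C₂, a₃, c₃, w₃, h₃, hZ₁, hC₂⟩ := hC.exists_mono hT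
    -- The horseshoe over `K ⟶ Z₀ ⟶ C`, with columns `K ⟶ T₀ ⟶ G` and `C ⟶ Z₁ ⟶ C₂`, embeds `G` in
    -- the cokernel `G'` of a monomorphism `Z₀ ⟶ T₀ ⊞ Z₁` inside `T`. Then `G'`, and so `G`, embeds
    -- in some `W₀` from `T`.
    obtain ⟨f, hf⟩ := hext _ hS hC T₀ hT₀ k
    obtain ⟨G', c, w', s, t, w'', hG', hst⟩ := exists_shortExact_biprod hS hk h₃ f hf
    obtain ⟨W₀, W', j, r, wj, hj, hW₀, hW'⟩ := hmono _ hG' hZ₀ (hsum _ _ hT₀ hZ₁)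
    obtain ⟨H, c', w₁, s', t', w₂, hH, hH'⟩ := exists_shortExact_comp hst hj
    refine ⟨W₀, H, _, c', w₁, hH, hW₀, ?_⟩
    refine HasCoresolution.extension hT hsum hext hH' ?_ hW'
    -- `C₂` has a coresolution with `e - 1` terms (truncated), padded here to `e` terms.
    cases e with
    | zero => exact hC₂
    | succ e => exact HasCoresolution.succ hT hC₂

/-- Morphisms from objects satisfying `T` lift along every epimorphism whose kernel has an
`n`-term resolution. -/
def LiftsAlong (T : ObjectProperty A) (n : ℕ) : Prop :=
  ∀ S : ShortComplex A, S.ShortExact → HasResolution T n S.X₁ →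
    ∀ Y : A, T Y → ∀ f : Y ⟶ S.X₃, ∃ g : Y ⟶ S.X₂, g ≫ S.g = f

/-- The dual of `HasResolution.hasCoresolution`. -/
theorem HasCoresolution.hasResolution {T : ObjectProperty A} [T.IsClosedUnderIsomorphisms]
    (hT : T 0) (hsum : ∀ X Y, T X → T Y → T (X ⊞ Y)) {e : ℕ} (hlift : LiftsAlong T e)
    (hepi : ∀ S : ShortComplex A, S.ShortExact → T S.X₂ → T S.X₃ →
      HasResolution T (e + 1) S.X₁)
    {n : ℕ} {G : A} (hG : HasCoresolution T n G) : HasResolution T (e + 1) G := by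
  rw [hasResolution_iff_hasCoresolution_op]
  refine HasResolution.hasCoresolution (T := T.op) ?_ ?_ ?_ ?_
    ((hasCoresolution_iff_hasResolution_op T n G).1 hG)
  · exact T.prop_of_iso ((isZero_zero A).iso (isZero_zero Aᵒᵖ).unop) hT
  · intro X Y hX hY
    -- Closure under sums in the opposite category: a biproduct there becomes a biproduct in `A`
    -- after exchanging projections and inclusions.
    let b : BinaryBicone X.unop Y.unop :=
      { pt := (X ⊞ Y).unop
        fst := (biprod.inl : X ⟶ X ⊞ Y).unop
        snd := (biprod.inr : Y ⟶ X ⊞ Y).unop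
        inl := (biprod.fst : X ⊞ Y ⟶ X).unop
        inr := (biprod.snd : X ⊞ Y ⟶ Y).unop
        inl_fst := by rw [← unop_comp, biprod.inl_fst, unop_id]
        inl_snd := by rw [← unop_comp, biprod.inr_fst, unop_zero]
        inr_fst := by rw [← unop_comp, biprod.inl_snd, unop_zero]
        inr_snd := by rw [← unop_comp, biprod.inr_snd, unop_id] }
    have hb : b.IsBilimit := isBinaryBilimitOfTotal b (by
      change (biprod.inl : X ⟶ X ⊞ Y).unop ≫ (biprod.fst : X ⊞ Y ⟶ X).unop +
        (biprod.inr : Y ⟶ X ⊞ Y).unop ≫ (biprod.snd : X ⊞ Y ⟶ Y).unop = 𝟙 _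
      rw [← unop_comp, ← unop_comp, ← unop_add, biprod.total, unop_id])
    exact T.prop_of_iso (biprod.uniqueUpToIso _ _ hb).symm (hsum _ _ hX hY)
  · intro S hS hn Y hY f
    obtain ⟨g, hg⟩ := hlift S.unop hS.unop ((hasResolution_iff_hasCoresolution_op T e _).2 hn)
      Y.unop hY f.unop
    exact ⟨g.op, Quiver.Hom.unop_inj hg⟩
  · intro S hS h₁ h₂
    exact (hasResolution_iff_hasCoresolution_op T (e + 1) _).1 (hepi S.unop hS.unop h₂ h₁)

end Resolutions

/-! ### Dimension shifting, rigidity and orthogonality -/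

section Ext

open scoped ZeroObject
open Abelian

variable {A : Type u} [Category.{v} A] [Abelian A] [HasExt.{w} A]

section DimensionShifting

variable {S : ShortComplex A} (hS : S.ShortExact)

include hS

theorem subsingleton_ext_X₁_left {Y : A} {i : ℕ} (h₂ : Subsingleton (Ext.{w} S.X₂ Y i))
    (h₃ : Subsingleton (Ext.{w} S.X₃ Y (i + 1))) : Subsingleton (Ext.{w} S.X₁ Y i) :=
  subsingleton_of_forall_eq 0 fun x => by
    obtain ⟨y, rfl⟩ := Ext.contravariant_sequence_exact₁ hS Y x (n₁ := i + 1) (by omega)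
      (Subsingleton.elim _ _)
    rw [Subsingleton.elim y 0, Ext.comp_zero]

theorem subsingleton_ext_X₃_left {Y : A} {i : ℕ} (h₁ : Subsingleton (Ext.{w} S.X₁ Y i))
    (h₂ : Subsingleton (Ext.{w} S.X₂ Y (i + 1))) : Subsingleton (Ext.{w} S.X₃ Y (i + 1)) :=
  subsingleton_of_forall_eq 0 fun x => by
    obtain ⟨y, rfl⟩ := Ext.contravariant_sequence_exact₃ hS Y x (Subsingleton.elim _ _)
      (n₀ := i) (by omega)
    rw [Subsingleton.elim y 0, Ext.comp_zero]

theorem subsingleton_ext_X₃_right {X : A} {i : ℕ} (h₂ : Subsingleton (Ext.{w} X S.X₂ i))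
    (h₁ : Subsingleton (Ext.{w} X S.X₁ (i + 1))) : Subsingleton (Ext.{w} X S.X₃ i) :=
  subsingleton_of_forall_eq 0 fun x => by
    obtain ⟨y, rfl⟩ := Ext.covariant_sequence_exact₃ X hS x (n₁ := i + 1) rfl
      (Subsingleton.elim _ _)
    rw [Subsingleton.elim y 0, Ext.zero_comp]

/-- In degree one, dimension shifting meets `Hom` rather than `Ext`: the connecting map is zero once
every morphism from `S.X₁` extends to `S.X₂`. -/
theorem subsingleton_ext_one_X₃_left {Y : A} (h₁ : ∀ f : S.X₁ ⟶ Y, ∃ g : S.X₂ ⟶ Y, S.f ≫ g = f)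
    (h₂ : Subsingleton (Ext.{w} S.X₂ Y 1)) : Subsingleton (Ext.{w} S.X₃ Y 1) :=
  subsingleton_of_forall_eq 0 fun x => by
    obtain ⟨y, rfl⟩ := Ext.contravariant_sequence_exact₃ hS Y x (Subsingleton.elim _ _)
      (n₀ := 0) rfl
    obtain ⟨f, rfl⟩ := Ext.homEquiv₀.symm.surjective y
    obtain ⟨g, rfl⟩ := h₁ f
    change hS.extClass.comp (Ext.mk₀ (S.f ≫ g)) _ = 0
    rw [← Ext.mk₀_comp_mk₀, ← Ext.comp_assoc _ _ _ (add_zero 1) (zero_add 0) (by simp),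
      hS.extClass_comp, Ext.zero_comp]

theorem exists_extension_of_subsingleton_ext {Y : A} (h : Subsingleton (Ext.{w} S.X₃ Y 1))
    (f : S.X₁ ⟶ Y) : ∃ g : S.X₂ ⟶ Y, S.f ≫ g = f := by
  obtain ⟨y, hy⟩ := Ext.contravariant_sequence_exact₁ hS Y (Ext.mk₀ f) (n₁ := 1) rfl
    (Subsingleton.elim _ _)
  obtain ⟨g, rfl⟩ := Ext.homEquiv₀.symm.surjective y
  exact ⟨g, Ext.mk₀_bijective _ _ |>.1 ((Ext.mk₀_comp_mk₀ _ _).symm.trans hy)⟩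

theorem exists_lift_of_subsingleton_ext {X : A} (h : Subsingleton (Ext.{w} X S.X₁ 1))
    (f : X ⟶ S.X₃) : ∃ g : X ⟶ S.X₂, g ≫ S.g = f := by
  obtain ⟨y, hy⟩ := Ext.covariant_sequence_exact₃ X hS (Ext.mk₀ f) (n₁ := 1) rfl
    (Subsingleton.elim _ _)
  obtain ⟨g, rfl⟩ := Ext.homEquiv₀.symm.surjective y
  exact ⟨g, Ext.mk₀_bijective _ _ |>.1 ((Ext.mk₀_comp_mk₀ _ _).symm.trans hy)⟩

end DimensionShifting

theorem subsingleton_ext_of_isZero_left {X : A} (h : IsZero X) (Y : A) (i : ℕ) :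
    Subsingleton (Ext.{w} X Y i) :=
  subsingleton_of_forall_eq 0 fun x => by
    rw [← Ext.mk₀_id_comp x, h.eq_of_src (𝟙 X) 0, Ext.mk₀_zero, Ext.zero_comp]

theorem subsingleton_ext_of_isZero_right {Y : A} (h : IsZero Y) (X : A) (i : ℕ) :
    Subsingleton (Ext.{w} X Y i) :=
  subsingleton_of_forall_eq 0 fun x => by
    rw [← Ext.comp_mk₀_id x, h.eq_of_src (𝟙 Y) 0, Ext.mk₀_zero, Ext.comp_zero]

/-- `Extⁱ(X, Y) = 0` for all `X`, `Y` satisfying `T` and all `1 ≤ i ≤ d - 1`. -/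
def IsRigid (d : ℕ) (T : ObjectProperty A) : Prop :=
  ∀ X Y : A, T X → T Y → ∀ i : ℕ, 1 ≤ i → i < d → Subsingleton (Ext.{w} X Y i)

variable {T : ObjectProperty A} {d : ℕ}

/-- Each term of the coresolution trades one degree of `Ext` for one step of length, which is why `i
+ n` is the bounded quantity. -/
theorem HasCoresolution.subsingleton_ext (hT : IsRigid d T) {n : ℕ} {C : A}
    (hC : HasCoresolution T n C) {Y : A} (hY : T Y) {i : ℕ} (hi : 1 ≤ i) (hin : i + n ≤ d) :
    Subsingleton (Ext.{w} C Y i) := by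
  induction n generalizing C i with
  | zero => exact subsingleton_ext_of_isZero_left hC Y i
  | succ n ih =>
    obtain ⟨Z, C', j, p, w, hS, hZ, hC'⟩ := hC
    exact subsingleton_ext_X₁_left hS (hT Z Y hZ hY i hi (by omega))
      (ih hC' (by omega) (by omega))

theorem HasResolution.subsingleton_ext (hT : IsRigid d T) {n : ℕ} {K : A}
    (hK : HasResolution T n K) {X : A} (hX : T X) {i : ℕ} (hi : 1 ≤ i) (hin : i + n ≤ d) :
    Subsingleton (Ext.{w} X K i) := by
  induction n generalizing K i with
  | zero => exact subsingleton_ext_of_isZero_right hK X i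
  | succ n ih =>
    obtain ⟨K', Z, j, p, w, hS, hZ, hK'⟩ := hK
    exact subsingleton_ext_X₃_right hS (hT X Z hX hZ i hi (by omega))
      (ih hK' (by omega) (by omega))

theorem IsRigid.extendsAlong {e : ℕ} (hT : IsRigid (e + 1) T) : ExtendsAlong T e :=
  fun _ hS hn _ hY f => exists_extension_of_subsingleton_ext hS
    (hn.subsingleton_ext hT hY le_rfl (by omega)) f

theorem IsRigid.liftsAlong {e : ℕ} (hT : IsRigid (e + 1) T) : LiftsAlong T e :=
  fun _ hS hn _ hY f => exists_lift_of_subsingleton_ext hS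
    (hn.subsingleton_ext hT hY le_rfl (by omega)) f

/-- An object with a coresolution that is `Ext`-orthogonal to `T` satisfies `T`. -/
theorem HasCoresolution.prop_of_ext [T.IsStableUnderRetracts] (hT₀ : T 0)
    (hT : IsRigid d T) {n : ℕ} (hn : n ≤ d) {G : A} (hG : HasCoresolution T n G)
    (hext : ∀ i : ℕ, 1 ≤ i → i < n → ∀ Y : A, T Y → Subsingleton (Ext.{w} Y G i)) : T G := by
  induction n generalizing G with
  | zero => exact T.prop_of_iso ((isZero_zero A).iso hG) hT₀
  | succ n ih =>
    obtain ⟨Z, C, j, p, w, hS, hZ, hC⟩ := hG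
    cases n with
    | zero =>
      have : IsIso j := by
        have := hS.mono_f
        have : Epi j := hS.exact.epi_f (IsZero.eq_of_tgt hC _ _)
        exact isIso_of_mono_of_epi j
      exact T.prop_of_iso (asIso j).symm hZ
    | succ n =>
      -- Orthogonality passes to `C` with the range shortened by one, so `C` lies in `T`; the first
      -- `Ext` of `C` by `G` then vanishes and the sequence splits.
      have hTC : T C := ih (by omega) hC fun i hi hin Y hY =>
        subsingleton_ext_X₃_right hS (hT Y Z hY hZ i hi (by omega))
          (hext (i + 1) (by omega) (by omega) Y hY)
      obtain ⟨s, hs⟩ := exists_lift_of_subsingleton_ext hS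
        (hext 1 le_rfl (by omega) C hTC) (𝟙 C)
      have : Mono j := hS.mono_f
      have : Mono (ShortComplex.mk j p w).f := this
      let σ := ShortComplex.Splitting.ofExactOfSection _ hS.exact s hs this
      exact T.prop_of_retract ⟨j, σ.r, σ.f_r⟩ hZ

/-- An object with a resolution that is `Ext`-orthogonal to `T` satisfies `T`. -/
theorem HasResolution.prop_of_ext [T.IsStableUnderRetracts] (hT₀ : T 0)
    (hT : IsRigid d T) {n : ℕ} (hn : n ≤ d) {G : A} (hG : HasResolution T n G)
    (hext : ∀ i : ℕ, 1 ≤ i → i < n → ∀ Y : A, T Y → Subsingleton (Ext.{w} G Y i)) : T G := by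
  induction n generalizing G with
  | zero => exact T.prop_of_iso ((isZero_zero A).iso hG) hT₀
  | succ n ih =>
    obtain ⟨K, Z, j, p, w, hS, hZ, hK⟩ := hG
    cases n with
    | zero =>
      have : IsIso p := by
        have := hS.epi_g
        have : Mono p := hS.exact.mono_g (IsZero.eq_of_src hK _ _)
        exact isIso_of_mono_of_epi p
      exact T.prop_of_iso (asIso p) hZ
    | succ n =>
      have hTK : T K := ih (by omega) hK fun i hi hin Y hY =>
        subsingleton_ext_X₁_left hS (hT Z Y hZ hY i hi (by omega))
          (hext (i + 1) (by omega) (by omega) Y hY)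
      obtain ⟨r, hr⟩ := exists_extension_of_subsingleton_ext hS
        (hext 1 le_rfl (by omega) K hTK) (𝟙 K)
      have : Epi (ShortComplex.mk j p w).g := hS.epi_g
      let σ := ShortComplex.Splitting.ofExactOfRetraction _ hS.exact r hr this
      exact T.prop_of_retract ⟨σ.s, p, σ.s_g⟩ hZ

/-- `G` has the beginning of a resolution by `n` objects satisfying `T` to which the functors
`Hom(-, Y)`, `Y` satisfying `T`, are exact. -/
def HasExactResolution (T : ObjectProperty A) : ℕ → A → Prop
  | 0, _ => True
  | n + 1, G => ∃ (K Z : A) (i : K ⟶ Z) (p : Z ⟶ G) (w : i ≫ p = 0),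
      (ShortComplex.mk i p w).ShortExact ∧ T Z ∧
      (∀ Y : A, T Y → ∀ f : K ⟶ Y, ∃ g : Z ⟶ Y, i ≫ g = f) ∧ HasExactResolution T n K

/-- Dimension shifting along the resolution down to degree one, where `Hom`-exactness takes over.
Only vanishing on `T` in degrees up to `i` is used. -/
theorem HasExactResolution.subsingleton_ext {n : ℕ} {G : A} (hG : HasExactResolution T n G)
    {i : ℕ} (hi : 1 ≤ i) (hin : i ≤ n) (hT : IsRigid (i + 1) T) {Y : A} (hY : T Y) :
    Subsingleton (Ext.{w} G Y i) := by
  induction n generalizing G i with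
  | zero => omega
  | succ n ih =>
    obtain ⟨K, Z, j, p, w, hS, hZ, hj, hK⟩ := hG
    obtain ⟨i, rfl⟩ : ∃ k, i = k + 1 := ⟨i - 1, by omega⟩
    have hZi := hT Z Y hZ hY (i + 1) hi (by omega)
    obtain rfl | hi' := Nat.eq_zero_or_pos i
    · exact subsingleton_ext_one_X₃_left hS (hj Y hY) hZi
    · exact subsingleton_ext_X₃_left hS (ih hK hi' (by omega)
        fun X Y hX hY k hk hki => hT X Y hX hY k hk (by omega)) hZi

/-- A class of objects with sufficiently long `Hom(-, T)`-exact resolutions starting with a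
projective object is rigid. -/
theorem isRigid_of_hasExactResolution {e : ℕ}
    (h : ∀ X : A, T X → ∃ (K P : A) (i : K ⟶ P) (p : P ⟶ X) (w : i ≫ p = 0),
      (ShortComplex.mk i p w).ShortExact ∧ Projective P ∧
      (∀ Y : A, T Y → ∀ f : K ⟶ Y, ∃ g : P ⟶ Y, i ≫ g = f) ∧ HasExactResolution T e K) :
    IsRigid (e + 2) T := by
  -- Rigidity is bootstrapped degree by degree. Projectivity of `P` lowers the degree by one; the
  -- remaining terms are merely in `T`, but on them only the smaller degrees, already settled, are
  -- needed.
  suffices ∀ n ≤ e + 2, IsRigid n T from this _ le_rfl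
  intro n
  induction n with
  | zero => intro _ _ _ _ _ i hi hi'; omega
  | succ n ih =>
    intro hn X Y hX hY i hi hin
    obtain hin' | rfl := Nat.lt_succ_iff_lt_or_eq.1 hin
    · exact ih (by omega) X Y hX hY i hi hin'
    · obtain ⟨K, P, j, p, w, hS, hP, hj, hK⟩ := h X hX
      obtain ⟨i, rfl⟩ : ∃ k, i = k + 1 := ⟨i - 1, by omega⟩
      have hPi : Subsingleton (Ext.{w} P Y (i + 1)) := Ext.subsingleton_of_projective ..
      obtain rfl | hi' := Nat.eq_zero_or_pos i
      · exact subsingleton_ext_one_X₃_left hS (hj Y hY) hPi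
      · exact subsingleton_ext_X₃_left hS (hK.subsingleton_ext hi' (by omega)
          (ih (by omega)) hY) hPi

end Ext

/-! ### Criterion for cluster tilting -/

section

open scoped ZeroObject

variable {A : Type u} [Category.{v} A] [Abelian A]

/-- A rigid class of objects that resolves every object and in which monomorphisms have
`d`-term coresolutions of their cokernels, and epimorphisms have `d`-term resolutions of their
kernels, is `d`-cluster tilting. -/
theorem isClusterTilting_of_isRigid {T : ObjectProperty A} [T.IsStableUnderRetracts] (hT₀ : T 0)
    (hsum : ∀ X Y, T X → T Y → T (X ⊞ Y)) {d : ℕ} (hd : 1 ≤ d)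
    (hrigid : haveI := HasExt.standard A; IsRigid d T)
    (hmono : ∀ S : ShortComplex A, S.ShortExact → T S.X₁ → T S.X₂ → HasCoresolution T d S.X₃)
    (hepi : ∀ S : ShortComplex A, S.ShortExact → T S.X₂ → T S.X₃ → HasResolution T d S.X₁)
    (hres : ∀ G : A, ∃ n, HasResolution T n G) : IsClusterTilting d T := by
  have := HasExt.standard A
  obtain ⟨e, rfl⟩ : ∃ e, d = e + 1 := ⟨d - 1, by omega⟩
  have hcores : ∀ G : A, HasCoresolution T (e + 1) G := fun G =>
    (hres G).choose_spec.hasCoresolution hT₀ hsum hrigid.extendsAlong hmono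
  have hres' : ∀ G : A, HasResolution T (e + 1) G := fun G =>
    (hcores G).hasResolution hT₀ hsum hrigid.liftsAlong hepi
  refine ⟨fun G => ?_, fun G => ?_, fun G => ?_, fun G => ?_, fun X => ⟨?_, ?_⟩,
    fun X => ⟨?_, ?_⟩⟩
  · obtain ⟨K, Z, j, p, w, hS, hZ, hK⟩ := hres' G
    exact ⟨Z, p, hZ, hrigid.liftsAlong _ hS hK⟩
  · obtain ⟨Z, C, j, p, w, hS, hZ, hC⟩ := hcores G
    exact ⟨Z, j, hZ, hrigid.extendsAlong _ hS hC⟩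
  · obtain ⟨K, Z, j, p, w, hS, hZ, hK⟩ := hres' G
    exact ⟨Z, p, hZ, hS.epi_g⟩
  · obtain ⟨Z, C, j, p, w, hS, hZ, hC⟩ := hcores G
    exact ⟨Z, j, hZ, hS.mono_f⟩
  · exact fun hX i hi hid Y hY => hrigid X Y hX hY i hi hid
  · exact fun h => (hres' X).prop_of_ext hT₀ hrigid le_rfl h
  · exact fun hX i hi hid Y hY => hrigid Y X hY hX i hi hid
  · exact fun h => (hcores X).prop_of_ext hT₀ hrigid le_rfl h

end

/-! ### Pointwise exactness of functors to abelian groups -/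

section FunctorCategory

variable {C : Type u} [Category.{v} C]

theorem functor_exact_iff (S : ShortComplex (C ⥤ AddCommGrpCat.{w})) :
    S.Exact ↔ ∀ X : C, Function.Exact (S.f.app X) (S.g.app X) := by
  have key : S.Exact ↔ ∀ X : C, (S.map ((evaluation C AddCommGrpCat.{w}).obj X)).Exact := by
    simp only [ShortComplex.exact_iff_isZero_homology]
    have e : ∀ X : C, (S.map ((evaluation C AddCommGrpCat.{w}).obj X)).homology ≅
      S.homology.obj X := fun X => S.mapHomologyIso ((evaluation C AddCommGrpCat.{w}).obj X)
    exact ⟨fun h X => (h.obj X).of_iso (e X),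
      fun h => Functor.isZero _ fun X => (h X).of_iso (e X).symm⟩
  rw [key]
  exact forall_congr' fun X => ShortComplex.ab_exact_iff_function_exact _

theorem functor_mono_iff {F G : C ⥤ AddCommGrpCat.{w}} (f : F ⟶ G) :
    Mono f ↔ ∀ X : C, Function.Injective (f.app X) := by
  simp only [NatTrans.mono_iff_mono_app, AddCommGrpCat.mono_iff_injective]

theorem functor_epi_iff {F G : C ⥤ AddCommGrpCat.{w}} (f : F ⟶ G) :
    Epi f ↔ ∀ X : C, Function.Surjective (f.app X) := by
  simp only [NatTrans.epi_iff_epi_app, AddCommGrpCat.epi_iff_surjective]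

end FunctorCategory

/-! ### Finitely presented functors form an abelian category -/

section WeakKernels

/-- Every morphism of `P` has a weak kernel. -/
class HasWeakKernels (P : Type u) [Category.{v} P] [Preadditive P] : Prop where
  exists_weakKernel {A B : P} (f : A ⟶ B) : ∃ (K : P) (k : K ⟶ A), ∀ Z : P, Function.Exact
    (fun h : Z ⟶ K => h ≫ k) (fun h : Z ⟶ A => h ≫ f)

variable {P : Type u} [Category.{v} P] [Preadditive P]

/-- The components of a morphism from a representable functor. -/
def yonedaApply {X : P} {G : Pᵒᵖ ⥤ AddCommGrpCat.{v}} (g : preadditiveYoneda.obj X ⟶ G) {Q : P} :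
    (Q ⟶ X) →+ G.obj (op Q) :=
  (g.app (op Q)).hom

variable {X Y : P} {G H : Pᵒᵖ ⥤ AddCommGrpCat.{v}}

theorem yonedaApply_map_comp (a : X ⟶ Y) (g : preadditiveYoneda.obj Y ⟶ G) {Q : P} (h : Q ⟶ X) :
    yonedaApply (preadditiveYoneda.map a ≫ g) h = yonedaApply g (h ≫ a) :=
  rfl

theorem yonedaApply_comp (g : preadditiveYoneda.obj X ⟶ G) (f : G ⟶ H) {Q : P} (h : Q ⟶ X) :
    yonedaApply (g ≫ f) h = f.app (op Q) (yonedaApply g h) :=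
  rfl

theorem map_yonedaApply (g : preadditiveYoneda.obj X ⟶ G) {Q R : P} (h : Q ⟶ X) (r : R ⟶ Q) :
    G.map r.op (yonedaApply g h) = yonedaApply g (r ≫ h) :=
  (ConcreteCategory.congr_hom (g.naturality r.op) h).symm

theorem yonedaApply_ext {g g' : preadditiveYoneda.obj X ⟶ G}
    (h : yonedaApply g (𝟙 X) = yonedaApply g' (𝟙 X)) : g = g' := by
  have key : ∀ (Q : P) (q : Q ⟶ X), yonedaApply g q = yonedaApply g' q := fun Q q => by
    rw [← Category.comp_id q, ← map_yonedaApply, ← map_yonedaApply, h]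
  ext Q q
  exact key Q.unop q

theorem exists_yoneda_lift {g : preadditiveYoneda.obj Y ⟶ G}
    (hg : ∀ Q, Function.Surjective (yonedaApply g (Q := Q))) (β : preadditiveYoneda.obj X ⟶ G) :
    ∃ a : X ⟶ Y, preadditiveYoneda.map a ≫ g = β := by
  obtain ⟨a, ha⟩ := hg X (yonedaApply β (𝟙 X))
  exact ⟨a, yonedaApply_ext (by rw [yonedaApply_map_comp, Category.id_comp, ha])⟩

theorem finitelyPresented_iff : finitelyPresented P G ↔
    ∃ (P₁ P₀ : P) (f : P₁ ⟶ P₀) (g : preadditiveYoneda.obj P₀ ⟶ G),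
      (∀ Q, Function.Surjective (yonedaApply g (Q := Q))) ∧
      ∀ (Q : P) (h : Q ⟶ P₀), yonedaApply g h = 0 ↔ ∃ t, t ≫ f = h :=
  ⟨fun ⟨P₁, P₀, f, g, hg⟩ => ⟨P₁, P₀, f, g, fun Q => (hg (op Q)).2, fun Q h => (hg (op Q)).1 h⟩,
    fun ⟨P₁, P₀, f, g, h₁, h₂⟩ => ⟨P₁, P₀, f, g, fun Q => ⟨fun h => h₂ Q.unop h, h₁ Q.unop⟩⟩⟩

theorem exists_yonedaApply_id_eq (hG : finitelyPresented P G) (x : G.obj (op X)) :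
    ∃ g : preadditiveYoneda.obj X ⟶ G, yonedaApply g (𝟙 X) = x := by
  obtain ⟨P₁, P₀, p, g, hg, -⟩ := finitelyPresented_iff.1 hG
  obtain ⟨h, rfl⟩ := hg X x
  exact ⟨preadditiveYoneda.map h ≫ g, by rw [yonedaApply_map_comp, Category.id_comp]⟩

instance : (finitelyPresented P).IsClosedUnderIsomorphisms where
  of_iso {G H} e := by
    rw [finitelyPresented_iff, finitelyPresented_iff]
    rintro ⟨P₁, P₀, f, g, h₁, h₂⟩
    have hinj : ∀ Q : P, Function.Injective (e.hom.app (op Q)) := fun Q =>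
      (functor_mono_iff e.hom).1 inferInstance _
    refine ⟨P₁, P₀, f, g ≫ e.hom, fun Q x => ?_, fun Q h => ?_⟩
    · obtain ⟨y, rfl⟩ := (functor_epi_iff e.hom).1 inferInstance (op Q) x
      obtain ⟨h, rfl⟩ := h₁ Q y
      exact ⟨h, rfl⟩
    · rw [yonedaApply_comp, ← h₂ Q h]
      exact map_eq_zero_iff _ (hinj Q)

theorem finitelyPresented_zero [HasZeroObject P] {G : Pᵒᵖ ⥤ AddCommGrpCat.{v}} (hG : IsZero G) :
    finitelyPresented P G := by
  open scoped ZeroObject in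
  have hG' : ∀ (Q : P) (x : G.obj (op Q)), x = 0 := fun Q x => by
    have h := (hG.obj (op Q)).eq_of_src (𝟙 _) 0
    exact ConcreteCategory.congr_hom h x
  rw [finitelyPresented_iff]
  refine ⟨0, 0, 0, 0, fun Q x => ⟨0, (hG' Q _).trans (hG' Q _).symm⟩, fun Q h => ?_⟩
  exact ⟨fun _ => ⟨0, (isZero_zero P).eq_of_tgt _ _⟩, fun _ => hG' _ _⟩

theorem fpMod_epi_of_surjective {G H : FPMod P} (f : G ⟶ H)
    (hf : ∀ Q : Pᵒᵖ, Function.Surjective (f.hom.app Q)) : Epi f :=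
  have : Epi ((finitelyPresented P).ι.map f) := (functor_epi_iff f.hom).2 hf
  (finitelyPresented P).ι.epi_of_epi_map this

theorem fpMod_mono_of_injective {G H : FPMod P} (f : G ⟶ H)
    (hf : ∀ Q : Pᵒᵖ, Function.Injective (f.hom.app Q)) : Mono f :=
  have : Mono ((finitelyPresented P).ι.map f) := (functor_mono_iff f.hom).2 hf
  (finitelyPresented P).ι.mono_of_mono_map this

variable [HasBinaryBiproducts P]

/-- Lift `f` to a map `a` between the generators; the cokernel has the generators of `H`, with the
relations `q` of `H` and the new relations `a`. -/
theorem finitelyPresented_cokernel (f : G ⟶ H) (hG : finitelyPresented P G)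
    (hH : finitelyPresented P H) : finitelyPresented P (cokernel f) := by
  rw [finitelyPresented_iff] at hG hH ⊢
  obtain ⟨P₁, P₀, p, g, hg, hp⟩ := hG
  obtain ⟨Q₁, Q₀, q, g', hg', hq⟩ := hH
  obtain ⟨a, ha⟩ := exists_yoneda_lift hg' (g ≫ f)
  have ha' : ∀ {Q : P} (t : Q ⟶ P₀), yonedaApply g' (t ≫ a) = f.app _ (yonedaApply g t) :=
    fun t => by rw [← yonedaApply_map_comp, ha, yonedaApply_comp]
  have hc := (functor_exact_iff (ShortComplex.mk f (cokernel.π f) (cokernel.condition f))).1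
    (ShortComplex.exact_of_g_is_cokernel _ (cokernelIsCokernel f))
  refine ⟨Q₁ ⊞ P₀, Q₀, biprod.desc q a, g' ≫ cokernel.π f, fun Q x => ?_, fun Q h => ?_⟩
  · obtain ⟨y, rfl⟩ := (functor_epi_iff (cokernel.π f)).1 inferInstance (op Q) x
    obtain ⟨h, rfl⟩ := hg' Q y
    exact ⟨h, rfl⟩
  · rw [yonedaApply_comp]
    refine (hc (op Q) _).trans ⟨?_, ?_⟩
    · rintro ⟨x, hx⟩
      obtain ⟨t, rfl⟩ := hg Q x
      change f.app _ _ = _ at hx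
      rw [← ha'] at hx
      obtain ⟨s, hs⟩ := (hq Q (h - t ≫ a)).1 (by rw [map_sub, hx, sub_self])
      exact ⟨biprod.lift s t, by rw [biprod.lift_desc, hs, sub_add_cancel]⟩
    · rintro ⟨t, rfl⟩
      refine ⟨yonedaApply g (t ≫ biprod.snd), ?_⟩
      have h0 := (hq Q (t ≫ biprod.fst ≫ q)).2 ⟨t ≫ biprod.fst, by simp⟩
      change f.app _ _ = _
      rw [← ha', biprod.desc_eq, Preadditive.comp_add, map_add, h0, zero_add, Category.assoc]

theorem finitelyPresented_kernel [HasWeakKernels P] (f : G ⟶ H)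
    (hG : finitelyPresented P G) (hH : finitelyPresented P H) :
    finitelyPresented P (kernel f) := by
  rw [finitelyPresented_iff] at hG hH ⊢
  obtain ⟨P₁, P₀, p, g, hg, hp⟩ := hG
  obtain ⟨Q₁, Q₀, q, g', hg', hq⟩ := hH
  obtain ⟨a, ha⟩ := exists_yoneda_lift hg' (g ≫ f)
  have ha' : ∀ {Q : P} (t : Q ⟶ P₀), yonedaApply g' (t ≫ a) = f.app _ (yonedaApply g t) :=
    fun t => by rw [← yonedaApply_map_comp, ha, yonedaApply_comp]
  have hinj : ∀ Q : P, Function.Injective ((kernel.ι f).app (op Q)) := fun Q =>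
    (functor_mono_iff (kernel.ι f)).1 inferInstance _
  -- `W` is a weak pullback of `a` and `q`: it generates the kernel, consisting of elements of `P₀`
  -- that `a` sends to relations of `H`. `V` is a weak pullback of `W ⟶ P₀` and `p`, giving the
  -- relations.
  obtain ⟨W, k, hk⟩ := HasWeakKernels.exists_weakKernel (biprod.desc a q)
  obtain ⟨V, l, hl⟩ := HasWeakKernels.exists_weakKernel (biprod.desc (k ≫ biprod.fst) p)
  have hkw : (k ≫ biprod.fst) ≫ a = (-(k ≫ biprod.snd)) ≫ q := by
    have : k ≫ biprod.desc a q = 0 := (hk W k).2 ⟨𝟙 W, Category.id_comp k⟩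
    rw [biprod.desc_eq, Preadditive.comp_add] at this
    rw [Preadditive.neg_comp]
    exact eq_neg_of_add_eq_zero_left (by simpa using this)
  have hlw : (l ≫ biprod.fst) ≫ k ≫ biprod.fst = (-(l ≫ biprod.snd)) ≫ p := by
    have : l ≫ biprod.desc (k ≫ biprod.fst) p = 0 := (hl V l).2 ⟨𝟙 V, Category.id_comp l⟩
    rw [biprod.desc_eq, Preadditive.comp_add] at this
    rw [Preadditive.neg_comp]
    exact eq_neg_of_add_eq_zero_left (by simpa using this)
  have hw : (preadditiveYoneda.map (k ≫ biprod.fst) ≫ g) ≫ f = 0 := by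
    refine yonedaApply_ext ?_
    rw [yonedaApply_comp, yonedaApply_map_comp, ← ha', Category.id_comp, hkw]
    exact (hq _ _).2 ⟨_, rfl⟩
  have hι : ∀ {Q : P} (t : Q ⟶ W), (kernel.ι f).app _ (yonedaApply (kernel.lift f _ hw) t) =
      yonedaApply g (t ≫ k ≫ biprod.fst) := fun t => by
    rw [← yonedaApply_comp, kernel.lift_ι, yonedaApply_map_comp]
  refine ⟨V, W, l ≫ biprod.fst, kernel.lift f _ hw, fun Q x => ?_, fun Q t => ?_⟩
  · obtain ⟨h, hh⟩ := hg Q ((kernel.ι f).app _ x)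
    have h0 : yonedaApply g' (h ≫ a) = 0 := by
      rw [ha', hh]
      exact ConcreteCategory.congr_hom (NatTrans.congr_app (kernel.condition f) (op Q)) x
    obtain ⟨s, hs⟩ := (hq Q _).1 h0
    obtain ⟨t, ht⟩ := (hk Q (biprod.lift h (-s))).1 (by
      change biprod.lift h (-s) ≫ biprod.desc a q = 0
      rw [biprod.lift_desc, Preadditive.neg_comp, hs, add_neg_cancel])
    refine ⟨t, hinj Q ?_⟩
    have ht' : t ≫ k ≫ biprod.fst = h := by
      rw [← Category.assoc]
      exact (congrArg (· ≫ biprod.fst) ht).trans (biprod.lift_fst _ _)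
    rw [hι, ht', hh]
  · have : yonedaApply (kernel.lift f _ hw) t = 0 ↔ yonedaApply g (t ≫ k ≫ biprod.fst) = 0 := by
      rw [← hι]
      exact (map_eq_zero_iff _ (hinj Q)).symm
    rw [this, hp]
    constructor
    · rintro ⟨r, hr⟩
      obtain ⟨z, hz⟩ := (hl Q (biprod.lift t (-r))).1 (by
        change biprod.lift t (-r) ≫ biprod.desc _ p = 0
        rw [biprod.lift_desc, Preadditive.neg_comp, hr, add_neg_cancel])
      refine ⟨z, ?_⟩
      rw [← Category.assoc]
      exact (congrArg (· ≫ biprod.fst) hz).trans (biprod.lift_fst _ _)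
    · rintro ⟨z, rfl⟩
      exact ⟨z ≫ (-(l ≫ biprod.snd)), by rw [Category.assoc, ← hlw]; simp⟩

theorem finitelyPresented_biprod (hG : finitelyPresented P G) (hH : finitelyPresented P H) :
    finitelyPresented P (G ⊞ H) := by
  rw [finitelyPresented_iff] at hG hH ⊢
  obtain ⟨P₁, P₀, p, g, hg, hp⟩ := hG
  obtain ⟨Q₁, Q₀, q, g', hg', hq⟩ := hH
  have hext : ∀ {Q : P} (x y : (G ⊞ H).obj (op Q)),
      (biprod.fst : G ⊞ H ⟶ G).app _ x = (biprod.fst : G ⊞ H ⟶ G).app _ y →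
      (biprod.snd : G ⊞ H ⟶ H).app _ x = (biprod.snd : G ⊞ H ⟶ H).app _ y → x = y := by
    intro Q x y h₁ h₂
    have h : ∀ z : (G ⊞ H).obj (op Q), (biprod.inl : G ⟶ G ⊞ H).app _
        ((biprod.fst : G ⊞ H ⟶ G).app _ z) + (biprod.inr : H ⟶ G ⊞ H).app _
        ((biprod.snd : G ⊞ H ⟶ H).app _ z) = z := fun z =>
      ConcreteCategory.congr_hom (NatTrans.congr_app (biprod.total (X := G) (Y := H)) (op Q)) z
    rw [← h x, ← h y, h₁, h₂]
  let γ : preadditiveYoneda.obj (P₀ ⊞ Q₀) ⟶ G ⊞ H :=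
    biprod.lift (preadditiveYoneda.map biprod.fst ≫ g) (preadditiveYoneda.map biprod.snd ≫ g')
  have h₁ : ∀ {Q : P} (h : Q ⟶ P₀ ⊞ Q₀), (biprod.fst : G ⊞ H ⟶ G).app _ (yonedaApply γ h) =
      yonedaApply g (h ≫ biprod.fst) := fun h => by
    rw [← yonedaApply_comp, biprod.lift_fst, yonedaApply_map_comp]
  have h₂ : ∀ {Q : P} (h : Q ⟶ P₀ ⊞ Q₀), (biprod.snd : G ⊞ H ⟶ H).app _ (yonedaApply γ h) =
      yonedaApply g' (h ≫ biprod.snd) := fun h => by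
    rw [← yonedaApply_comp, biprod.lift_snd, yonedaApply_map_comp]
  refine ⟨P₁ ⊞ Q₁, P₀ ⊞ Q₀, biprod.map p q, γ, fun Q x => ?_, fun Q h => ?_⟩
  · obtain ⟨h, hh⟩ := hg Q ((biprod.fst : G ⊞ H ⟶ G).app _ x)
    obtain ⟨h', hh'⟩ := hg' Q ((biprod.snd : G ⊞ H ⟶ H).app _ x)
    exact ⟨biprod.lift h h', hext _ _ (by rw [h₁, biprod.lift_fst, hh])
      (by rw [h₂, biprod.lift_snd, hh'])⟩
  · constructor
    · intro h0
      obtain ⟨t, ht⟩ := (hp Q (h ≫ biprod.fst)).1 (by rw [← h₁, h0, map_zero])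
      obtain ⟨t', ht'⟩ := (hq Q (h ≫ biprod.snd)).1 (by rw [← h₂, h0, map_zero])
      exact ⟨biprod.lift t t', by apply biprod.hom_ext <;> simp [ht, ht']⟩
    · rintro ⟨t, rfl⟩
      refine hext _ _ ?_ ?_
      · rw [h₁, map_zero]
        exact (hp _ _).2 ⟨t ≫ biprod.fst, by simp⟩
      · rw [h₂, map_zero]
        exact (hq _ _).2 ⟨t ≫ biprod.snd, by simp⟩

instance [HasZeroObject P] : (finitelyPresented P).ContainsZero where
  exists_zero := ⟨_, isZero_zero _, finitelyPresented_zero (isZero_zero _)⟩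

instance : (finitelyPresented P).IsClosedUnderCokernels where
  cokernels_le := by
    rintro _ ⟨f, k, hk, hG, hH⟩
    exact (finitelyPresented P).prop_of_iso
      ((cokernelIsCokernel f).coconePointUniqueUpToIso hk) (finitelyPresented_cokernel f hG hH)

instance [HasWeakKernels P] : (finitelyPresented P).IsClosedUnderKernels where
  kernels_le := by
    rintro _ ⟨f, k, hk, hG, hH⟩
    exact (finitelyPresented P).prop_of_iso
      ((kernelIsKernel f).conePointUniqueUpToIso hk) (finitelyPresented_kernel f hG hH)

instance [HasZeroObject P] : (finitelyPresented P).IsClosedUnderFiniteProducts :=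
  have : (finitelyPresented P).IsClosedUnderBinaryProducts :=
    .mk' (by
      rintro _ ⟨F, hF⟩
      exact (finitelyPresented P).prop_of_iso
        ((biprod.isoProd _ _) ≪≫ (HasLimit.isoOfNatIso (diagramIsoPair F)).symm)
        (finitelyPresented_biprod (hF ⟨.left⟩) (hF ⟨.right⟩)))
  .mk'

/-- Kernels and cokernels are those of the ambient functor category, so the faithful inclusion
preserves and reflects exactness. -/
theorem fpMod_exact_iff [HasZeroObject P] [HasWeakKernels P] (S : ShortComplex (FPMod P)) :
    S.Exact ↔ ∀ Q : Pᵒᵖ, Function.Exact (S.f.hom.app Q) (S.g.hom.app Q) := by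
  have : (finitelyPresented P).ι.PreservesHomology :=
    { preservesKernels := fun _ _ f => (finitelyPresented P).preservesKernels_ι f
      preservesCokernels := fun _ _ f => (finitelyPresented P).preservesCokernels_ι f }
  exact (ShortComplex.exact_map_iff_of_faithful S (finitelyPresented P).ι).symm.trans
    (functor_exact_iff (S.map (finitelyPresented P).ι))

theorem surjective_app_of_epi [HasZeroObject P] [HasWeakKernels P] {G H : FPMod P} (f : G ⟶ H)
    [Epi f] (Q : Pᵒᵖ) : Function.Surjective (f.hom.app Q) := by
  have h := (fpMod_exact_iff (ShortComplex.mk f (0 : H ⟶ H) comp_zero)).1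
    ((ShortComplex.exact_iff_epi _ rfl).2 ‹_›) Q
  exact fun x => (h x).1 rfl

end WeakKernels

/-! ### Cutting long exact sequences into short ones -/

section ExactSequences

variable {A : Type u} [Category.{v} A] [Abelian A]

theorem shortExact_kernel_lift {S : ShortComplex A} (hS : S.Exact) :
    (ShortComplex.mk (kernel.ι S.f) (kernel.lift S.g S.f S.zero)
      (by rw [← cancel_mono (kernel.ι S.g)]; simp)).ShortExact := by
  have : Epi (kernel.lift S.g S.f S.zero) := hS.epi_kernelLift
  refine .mk' ?_ inferInstance this
  refine ShortComplex.exact_of_f_is_kernel _ ?_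
  exact isKernelOfComp (kernel.ι S.g) S.f (kernelIsKernel S.f) _ (kernel.lift_ι _ _ _)

theorem shortExact_cokernel_desc {S : ShortComplex A} (hS : S.Exact) :
    (ShortComplex.mk (cokernel.desc S.f S.g S.zero) (cokernel.π S.g)
      (by rw [← cancel_epi (cokernel.π S.f)]; simp)).ShortExact := by
  have : Mono (cokernel.desc S.f S.g S.zero) := hS.mono_cokernelDesc
  refine .mk' ?_ this inferInstance
  refine ShortComplex.exact_of_g_is_cokernel _ ?_
  exact isCokernelOfComp (cokernel.π S.f) S.g (cokernelIsCokernel S.g) _ (cokernel.π_desc _ _ _)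

variable {T : ObjectProperty A} {d : ℕ} {S : ComposableArrows A (d + 1)}

theorem hasResolution_kernel (hS : S.Exact) [Mono (S.map' 0 1)]
    (hT : ∀ i (hi : i ≤ d + 1), T (S.obj' i)) (i : ℕ) (hi : i ≤ d) :
    HasResolution T i (kernel (S.map' i (i + 1))) := by
  induction i with
  | zero => exact isZero_kernel_of_mono _
  | succ i ih => exact ⟨_, _, _, _, _, shortExact_kernel_lift (hS.exact i), hT i (by omega), ih (by omega)⟩

theorem hasCoresolution_cokernel (hS : S.Exact) [Epi (S.map' d (d + 1))]
    (hT : ∀ i (hi : i ≤ d + 1), T (S.obj' i)) (k i : ℕ) (hi : i + k = d) :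
    HasCoresolution T k (cokernel (S.map' i (i + 1))) := by
  induction k generalizing i with
  | zero =>
    obtain rfl : i = d := by omega
    exact isZero_cokernel_of_epi _
  | succ k ih =>
    exact ⟨_, _, _, _, _, shortExact_cokernel_desc (hS.exact i), hT (i + 2) (by omega),
      ih (i + 1) (by omega)⟩

/-- By exactness the kernel is a quotient of `S.obj' (j + 1)`. Pulled back there, `f` kills the
incoming map, so `hhom` factors it through the next term. -/
theorem exists_extension_kernel (hS : S.Exact)
    (hhom : ∀ (Y : A), T Y → ∀ (i : ℕ) (hi : i < d), ∀ h : S.obj' (i + 1) ⟶ Y,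
      S.map' i (i + 1) ≫ h = 0 → ∃ h' : S.obj' (i + 2) ⟶ Y, S.map' (i + 1) (i + 2) ≫ h' = h)
    (j : ℕ) (hj : j + 2 ≤ d) (Y : A) (hY : T Y) (f : kernel (S.map' (j + 2) (j + 3)) ⟶ Y) :
    ∃ g : S.obj' (j + 2) ⟶ Y, kernel.ι (S.map' (j + 2) (j + 3)) ≫ g = f := by
  have hw : S.map' (j + 1) (j + 2) ≫ S.map' (j + 2) (j + 3) = 0 := hS.zero (j + 1)
  have hw' : S.map' j (j + 1) ≫ S.map' (j + 1) (j + 2) = 0 := hS.zero j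
  let l := kernel.lift _ _ hw
  have : Epi l := (hS.exact (j + 1)).epi_kernelLift
  obtain ⟨g, hg⟩ := hhom Y hY j (by omega) (l ≫ f) (by
    have : S.map' j (j + 1) ≫ l = 0 := by
      rw [← cancel_mono (kernel.ι _), Category.assoc, kernel.lift_ι, hw', zero_comp]
    rw [reassoc_of% this, zero_comp])
  refine ⟨g, ?_⟩
  rw [← cancel_epi l, ← hg, ← Category.assoc, kernel.lift_ι]

theorem hasExactResolution_kernel (hS : S.Exact)
    (hT : ∀ i (hi : i ≤ d + 1), T (S.obj' i))
    (hhom : ∀ (Y : A), T Y → ∀ (i : ℕ) (hi : i < d), ∀ h : S.obj' (i + 1) ⟶ Y,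
      S.map' i (i + 1) ≫ h = 0 → ∃ h' : S.obj' (i + 2) ⟶ Y, S.map' (i + 1) (i + 2) ≫ h' = h)
    (k : ℕ) (hk : k + 2 ≤ d) : HasExactResolution T k (kernel (S.map' (k + 2) (k + 3))) := by
  induction k with
  | zero => trivial
  | succ k ih =>
    exact ⟨_, _, _, _, _, shortExact_kernel_lift (hS.exact (k + 2)), hT (k + 2) (by omega),
      exists_extension_kernel hS hhom k (by omega), ih (by omega)⟩

/-- A cokernel of a morphism in `T` is resolved as soon as the kernel is. -/
theorem HasResolution.of_kernel {X Y : A} (f : X ⟶ Y) {n : ℕ} (hX : T X) (hY : T Y)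
    (h : HasResolution T n (kernel f)) : HasResolution T (n + 2) (cokernel f) :=
  ⟨_, Y, _, _, _, shortExact_kernel (cokernel.π f), hY, _, X, _, _, _,
    shortExact_kernel_lift (ShortComplex.exact_of_g_is_cokernel
      (ShortComplex.mk f (cokernel.π f) (cokernel.condition f)) (cokernelIsCokernel f)), hX, h⟩

end ExactSequences

/-! ### Projective objects: biproducts and weak kernels -/

section ProjectiveObjects

open scoped ZeroObject

variable {M : Type u} [Category.{v} M] [Preadditive M]

instance [HasZeroObject M] : (isProjective M).ContainsZero where
  exists_zero := ⟨0, isZero_zero M, (isZero_zero M).projective⟩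

instance : (isProjective M).IsClosedUnderIsomorphisms where
  of_iso e h := Projective.of_iso e h

instance [HasFiniteBiproducts M] : (isProjective M).IsClosedUnderFiniteProducts :=
  have := hasBinaryBiproducts_of_finite_biproducts M
  have : (isProjective M).IsClosedUnderBinaryProducts :=
    .mk' (by
      rintro _ ⟨F, hF⟩
      have h₁ : Projective (F.obj ⟨.left⟩) := hF _
      have h₂ : Projective (F.obj ⟨.right⟩) := hF _
      have h₃ : Projective (F.obj ⟨.left⟩ ⊞ F.obj ⟨.right⟩) := inferInstance
      exact (isProjective M).prop_of_iso
        ((biprod.isoProd _ _) ≪≫ (HasLimit.isoOfNatIso (diagramIsoPair F)).symm) h₃)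
  .mk'

instance [HasFiniteBiproducts M] : HasFiniteBiproducts (Proj M) :=
  .of_hasFiniteProducts

variable {d : ℕ}

theorem IsDAbelian.hasWeakKernels (hd : 1 ≤ d) (hM : IsDAbelian d M) : HasWeakKernels M := by
  obtain ⟨e, rfl⟩ : ∃ e, d = e + 1 := ⟨d - 1, by omega⟩
  refine ⟨fun {A B} f => ?_⟩
  obtain ⟨S, hS, hk⟩ := hM.exists_dKernel f
  cases hS
  exact ⟨_, _, fun Z => hk.exact Z e (by omega)⟩

instance [EnoughProjectives M] [HasWeakKernels M] : HasWeakKernels (Proj M) := by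
  refine ⟨fun {A B} f => ?_⟩
  obtain ⟨K, k, hk⟩ := HasWeakKernels.exists_weakKernel f.hom
  refine ⟨⟨Projective.over K, Projective.projective_over K⟩,
    ObjectProperty.homMk (Projective.π K ≫ k), fun Z h => ?_⟩
  have : Projective Z.obj := Z.property
  have h0 : h ≫ f = 0 ↔ h.hom ≫ f.hom = 0 :=
    ⟨fun h => congrArg InducedCategory.Hom.hom h, fun h => ObjectProperty.hom_ext _ h⟩
  refine h0.trans ((hk Z.obj h.hom).trans ⟨?_, ?_⟩)
  · rintro ⟨t, ht⟩
    refine ⟨ObjectProperty.homMk (Projective.factorThru t (Projective.π K)),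
      ObjectProperty.hom_ext _ ?_⟩
    change Projective.factorThru t (Projective.π K) ≫ Projective.π K ≫ k = h.hom
    rw [Projective.factorThru_comp_assoc]
    exact ht
  · rintro ⟨t, rfl⟩
    exact ⟨t.hom ≫ Projective.π K, Category.assoc _ _ _⟩

end ProjectiveObjects

/-! ### Full faithfulness of `F` -/

section Functor

variable {M : Type u} [Category.{v} M] [Preadditive M] {d : ℕ} (hd : 1 ≤ d) (hM : IsDAbelian d M)
  [EnoughProjectives M]

/-- Elements of `F(X)` at `Q` are morphisms from `Q` to `X`. -/
def toFPModApply {X Y : M} (α : (toFPMod hd hM).obj X ⟶ (toFPMod hd hM).obj Y) (Q : Proj M) :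
    (Q.obj ⟶ X) →+ (Q.obj ⟶ Y) :=
  (α.hom.app (op Q)).hom

theorem toFPModApply_map {X Y : M} (f : X ⟶ Y) (Q : Proj M) (h : Q.obj ⟶ X) :
    toFPModApply hd hM ((toFPMod hd hM).map f) Q h = h ≫ f :=
  rfl

theorem toFPModApply_comp {X Y : M} (α : (toFPMod hd hM).obj X ⟶ (toFPMod hd hM).obj Y)
    {Q R : Proj M} (r : R ⟶ Q) (h : Q.obj ⟶ X) :
    toFPModApply hd hM α R (r.hom ≫ h) = r.hom ≫ toFPModApply hd hM α Q h :=
  ConcreteCategory.congr_hom (α.hom.naturality r.op) h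

theorem toFPMod_hom_ext {X Y : M} {α β : (toFPMod hd hM).obj X ⟶ (toFPMod hd hM).obj Y}
    (h : ∀ Q q, toFPModApply hd hM α Q q = toFPModApply hd hM β Q q) : α = β := by
  apply ObjectProperty.hom_ext
  ext Q q
  exact h Q.unop q

instance : (toFPMod hd hM).Additive where
  map_add {_ _ f g} := toFPMod_hom_ext hd hM fun _ q => Preadditive.comp_add _ _ _ q f g

/-- Evaluate at the chosen projective over `X`, on the element `Projective.π X`, which is an
epimorphism. -/
instance : (toFPMod hd hM).Faithful where
  map_injective {X Y f g} h := by
    rw [← cancel_epi (Projective.π X)]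
    let Q : Proj M := ⟨Projective.over X, Projective.projective_over X⟩
    exact congrArg (fun α => toFPModApply hd hM α Q (Projective.π X)) h

omit [EnoughProjectives M] in
include hd hM in
/-- An epimorphism is a cokernel of each of its weak kernels. -/
theorem exists_desc_of_epi {A B K Y : M} (f : A ⟶ B) [Epi f] (k : K ⟶ A)
    (hk : ∀ {Z : M} (h : Z ⟶ A), h ≫ f = 0 → ∃ t, t ≫ k = h) (g : A ⟶ Y) (hg : k ≫ g = 0) :
    ∃ g' : B ⟶ Y, f ≫ g' = g := by
  obtain ⟨e, rfl⟩ : ∃ e, d = e + 1 := ⟨d - 1, by omega⟩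
  obtain ⟨S, hS, hSk⟩ := hM.exists_dKernel f
  cases hS
  -- The `d`-kernel of `f` is `d`-exact, so morphisms killed by its last map descend along `f`; that
  -- last map factors through the weak kernel `k`.
  have hS := (hM.isDExact_of_epi S ‹_› hSk).isDCokernel
  obtain ⟨t, ht⟩ := hk (S.map' e (e + 1))
    ((hSk.exact _ e (by omega) _).2 ⟨𝟙 _, Category.id_comp _⟩)
  obtain ⟨g', hg'⟩ := (hS.exact Y e (by omega) g).1 (by
    change S.map' e (e + 1) ≫ g = 0
    rw [← ht, Category.assoc, hg, comp_zero])
  exact ⟨g', hg'⟩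

/-- The value of `α` on `Projective.π X` vanishes on a weak kernel of `Projective.π X`, hence
descends to `g : X ⟶ Y`. Every element of `F(X)` factors through `Projective.π X`, so naturality
gives `α = F(g)`. -/
instance : (toFPMod hd hM).Full where
  map_surjective {X Y} α := by
    obtain ⟨K, k, hk⟩ := (hM.hasWeakKernels hd).exists_weakKernel (Projective.π X)
    let P₀ : Proj M := ⟨Projective.over X, Projective.projective_over X⟩
    let P₁ : Proj M := ⟨Projective.over K, Projective.projective_over K⟩
    let f : P₁ ⟶ P₀ := ObjectProperty.homMk (Projective.π K ≫ k)
    have hk0 : k ≫ Projective.π X = 0 := (hk _ k).2 ⟨𝟙 K, Category.id_comp k⟩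
    have hf : f.hom ≫ Projective.π X = 0 := by
      change (Projective.π K ≫ k) ≫ _ = 0
      rw [Category.assoc, hk0, comp_zero]
    obtain ⟨g, hg⟩ := exists_desc_of_epi hd hM (Projective.π X) k
      (fun h hh => (hk _ h).1 hh) (toFPModApply hd hM α P₀ (Projective.π X)) (by
        rw [← cancel_epi (Projective.π K), comp_zero, ← Category.assoc]
        change f.hom ≫ _ = 0
        rw [← toFPModApply_comp, hf, map_zero])
    refine ⟨g, toFPMod_hom_ext hd hM fun Q q => ?_⟩
    have : Projective Q.obj := Q.property
    let r : Q ⟶ P₀ := ObjectProperty.homMk (Projective.factorThru q (Projective.π X))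
    have hr : r.hom ≫ Projective.π X = q := Projective.factorThru_comp _ _
    rw [toFPModApply_map, ← hr, toFPModApply_comp, Category.assoc, hg]

end Functor

/-! ### The essential image of `F` satisfies the criterion -/

section EssImage

variable {M : Type u} [Category.{v} M] [Preadditive M] {d : ℕ} (hd : 1 ≤ d) (hM : IsDAbelian d M)
  [EnoughProjectives M]

/-- Representable functors on projective objects, as objects of the image of `F`. -/
def restrictedYonedaIso (P : Proj M) :
    (restrictedYoneda M).obj P.obj ≅ preadditiveYoneda.obj P :=
  NatIso.ofComponents (fun Q => AddEquiv.toAddCommGrpIso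
    { toFun := fun h => (ObjectProperty.homMk h : Q.unop ⟶ P)
      invFun := fun h => (h : Q.unop ⟶ P).hom
      left_inv := fun _ => rfl
      right_inv := fun _ => rfl
      map_add' := fun _ _ => rfl }) fun _ => rfl

instance isStableUnderRetracts_essImage : (toFPMod hd hM).essImage.IsStableUnderRetracts where
  of_retract {Y X} r h := by
    obtain ⟨X', ⟨e⟩⟩ := h
    have := hM.isIdempotentComplete
    let i : Y ⟶ (toFPMod hd hM).obj X' := r.i ≫ e.inv
    let p : (toFPMod hd hM).obj X' ⟶ Y := e.hom ≫ r.r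
    have hip : i ≫ p = 𝟙 Y := by simp [i, p]
    -- The idempotent on `F(X')` defining the retract lifts to an idempotent of `X'`, which splits
    -- in `M`.
    obtain ⟨c, hc⟩ := (toFPMod hd hM).map_surjective (p ≫ i)
    obtain ⟨Z, j, q, hjq, hqj⟩ := IsIdempotentComplete.idempotents_split X' c
      ((toFPMod hd hM).map_injective (by
        rw [Functor.map_comp, hc, Category.assoc, reassoc_of% hip]))
    have hqj' : (toFPMod hd hM).map q ≫ (toFPMod hd hM).map j = p ≫ i := by
      rw [← Functor.map_comp, hqj, hc]
    have hjq' : (toFPMod hd hM).map j ≫ (toFPMod hd hM).map q = 𝟙 _ := by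
      rw [← Functor.map_comp, hjq, CategoryTheory.Functor.map_id]
    refine ⟨Z, ⟨⟨(toFPMod hd hM).map j ≫ p, i ≫ (toFPMod hd hM).map q, ?_, ?_⟩⟩⟩
    · rw [Category.assoc, ← reassoc_of% hqj', hjq', Category.comp_id, hjq']
    · rw [Category.assoc, reassoc_of% hqj', hip, Category.comp_id, hip]

instance epi_map_toFPMod {X Y : M} (f : X ⟶ Y) [Epi f] : Epi ((toFPMod hd hM).map f) :=
  fpMod_epi_of_surjective _ fun Q h => by
    have key : ∀ (R : M), Projective R → ∀ h : R ⟶ Y, ∃ t : R ⟶ X, t ≫ f = h := fun R _ h =>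
      ⟨Projective.factorThru h f, Projective.factorThru_comp _ _⟩
    exact key Q.unop.obj Q.unop.property h

theorem exists_map_iso {G H : FPMod (Proj M)} (f : G ⟶ H) (hG : (toFPMod hd hM).essImage G)
    (hH : (toFPMod hd hM).essImage H) : ∃ (X Y : M) (g : X ⟶ Y) (e : (toFPMod hd hM).obj X ≅ G)
      (e' : (toFPMod hd hM).obj Y ≅ H), (toFPMod hd hM).map g ≫ e'.hom = e.hom ≫ f := by
  obtain ⟨X, ⟨e⟩⟩ := hG
  obtain ⟨Y, ⟨e'⟩⟩ := hH
  obtain ⟨g, hg⟩ := (toFPMod hd hM).map_surjective (e.hom ≫ f ≫ e'.inv)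
  exact ⟨X, Y, g, e, e', by rw [hg]; simp⟩

variable {S : ComposableArrows M (d + 1)}

variable {hM} in
theorem IsDKernel.mono_map (hS : IsDKernel S) :
    Mono (ComposableArrows.map' (S ⋙ toFPMod hd hM : ComposableArrows _ (d + 1)) 0 1) :=
  fpMod_mono_of_injective _ fun Q => hS.injective Q.unop.obj

theorem prop_essImage_obj' (i : ℕ) (hi : i ≤ d + 1) : (toFPMod hd hM).essImage
    (ComposableArrows.obj' (S ⋙ toFPMod hd hM : ComposableArrows _ (d + 1)) i) :=
  Functor.obj_mem_essImage _ _

variable [HasFiniteBiproducts M]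

open scoped ZeroObject in
theorem prop_essImage_zero : (toFPMod hd hM).essImage 0 :=
  ⟨0, ⟨(toFPMod hd hM).mapZeroObject⟩⟩

variable [HasBinaryBiproducts (Proj M)] [HasWeakKernels M]

theorem prop_essImage_biprod (G H : FPMod (Proj M)) (hG : (toFPMod hd hM).essImage G)
    (hH : (toFPMod hd hM).essImage H) : (toFPMod hd hM).essImage (G ⊞ H) := by
  have := hasBinaryBiproducts_of_finite_biproducts M
  have := preservesBinaryBiproducts_of_preservesBiproducts (toFPMod hd hM)
  obtain ⟨X, ⟨e⟩⟩ := hG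
  obtain ⟨Y, ⟨e'⟩⟩ := hH
  exact ⟨X ⊞ Y, ⟨(toFPMod hd hM).mapBiprod X Y ≪≫ biprod.mapIso e e'⟩⟩

/-- By Yoneda a morphism from `F(P)` is an element at `P`, and epimorphisms of `mod P` are pointwise
surjective. -/
instance projective_toFPMod_obj (P : M) [Projective P] : Projective ((toFPMod hd hM).obj P) where
  factors {G H} α ε _ := by
    let Q : Proj M := ⟨P, ‹_›⟩
    let φ := restrictedYonedaIso Q
    obtain ⟨x, hx⟩ := surjective_app_of_epi ε (op Q) (yonedaApply (φ.inv ≫ α.hom) (𝟙 Q))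
    obtain ⟨g, rfl⟩ := exists_yonedaApply_id_eq G.property x
    refine ⟨ObjectProperty.homMk (φ.hom ≫ g), ObjectProperty.hom_ext _ ?_⟩
    have : g ≫ ε.hom = φ.inv ≫ α.hom := yonedaApply_ext hx
    change (φ.hom ≫ g) ≫ ε.hom = α.hom
    rw [Category.assoc, this]
    exact φ.hom_inv_id_assoc α.hom

-- Exactness in `mod P` is tested at projectives `Q`, where `F` becomes `M(Q, -)`.
variable {hM} in
theorem IsDKernel.exact_map (hS : IsDKernel S) :
    ComposableArrows.Exact (S ⋙ toFPMod hd hM : ComposableArrows _ (d + 1)) := by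
  have hw : ∀ (i : ℕ) (hi : i < d), S.map' i (i + 1) ≫ S.map' (i + 1) (i + 2) = 0 := fun i hi =>
    (hS.exact _ i hi _).2 ⟨𝟙 _, Category.id_comp _⟩
  have hw' : ComposableArrows.IsComplex (S ⋙ toFPMod hd hM : ComposableArrows _ (d + 1)) :=
    ⟨fun i hi => by
      change (toFPMod hd hM).map (S.map' i (i + 1)) ≫
        (toFPMod hd hM).map (S.map' (i + 1) (i + 2)) = 0
      rw [← Functor.map_comp, hw i (by omega), Functor.map_zero]⟩
  exact ⟨hw', fun i hi => (fpMod_exact_iff _).2 fun Q => hS.exact Q.unop.obj i (by omega)⟩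

theorem hasResolution_kernel_map {X Y : M} (f : X ⟶ Y) :
    HasResolution (toFPMod hd hM).essImage d (kernel ((toFPMod hd hM).map f)) := by
  obtain ⟨S, hS, hk⟩ := hM.exists_dKernel f
  cases hS
  have := hk.mono_map (hM := hM) hd
  exact hasResolution_kernel (hk.exact_map hd) (prop_essImage_obj' hd hM) d le_rfl

/-- Exactness under `F` comes from the `d`-kernel property, which the axiom on monomorphisms
supplies for a `d`-cokernel of `f`. -/
theorem hasCoresolution_cokernel_map {X Y : M} (f : X ⟶ Y) [Mono f] :
    HasCoresolution (toFPMod hd hM).essImage d (cokernel ((toFPMod hd hM).map f)) := by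
  obtain ⟨S, hS, hc⟩ := hM.exists_dCokernel f
  cases hS
  have hk := (hM.isDExact_of_mono S ‹_› hc).isDKernel
  have : Epi (S.map' d (d + 1)) := ⟨fun g h w => hc.injective _ w⟩
  have : Epi (ComposableArrows.map' (S ⋙ toFPMod hd hM : ComposableArrows _ (d + 1)) d (d + 1)) :=
    epi_map_toFPMod hd hM _
  exact hasCoresolution_cokernel (hk.exact_map hd) (prop_essImage_obj' hd hM) d 0 (zero_add d)

theorem hasResolution_of_shortExact (S : ShortComplex (FPMod (Proj M))) (hS : S.ShortExact)
    (h₂ : (toFPMod hd hM).essImage S.X₂) (h₃ : (toFPMod hd hM).essImage S.X₃) :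
    HasResolution (toFPMod hd hM).essImage d S.X₁ := by
  obtain ⟨X, Y, g, e, e', hg⟩ := exists_map_iso hd hM S.g h₂ h₃
  exact (hasResolution_kernel_map hd hM g).of_iso ((kernel.mapIso _ _ e e' hg).trans
    ((kernelIsKernel S.g).conePointUniqueUpToIso hS.fIsKernel))

theorem hasCoresolution_of_shortExact (S : ShortComplex (FPMod (Proj M))) (hS : S.ShortExact)
    (h₁ : (toFPMod hd hM).essImage S.X₁) (h₂ : (toFPMod hd hM).essImage S.X₂) :
    HasCoresolution (toFPMod hd hM).essImage d S.X₃ := by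
  obtain ⟨X, Y, g, e, e', hg⟩ := exists_map_iso hd hM S.f h₁ h₂
  have := hS.mono_f
  have : Mono ((toFPMod hd hM).map g) := by
    rw [← Iso.eq_comp_inv] at hg
    rw [hg]
    infer_instance
  have : Mono g := (toFPMod hd hM).mono_of_mono_map this
  exact (hasCoresolution_cokernel_map hd hM g).of_iso ((cokernel.mapIso _ _ e e' hg).trans
    ((cokernelIsCokernel S.f).coconePointUniqueUpToIso hS.gIsCokernel))

theorem exists_hasResolution (G : FPMod (Proj M)) :
    ∃ n, HasResolution (toFPMod hd hM).essImage n G := by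
  obtain ⟨P₁, P₀, f, g, hg⟩ := G.property
  let p : (toFPMod hd hM).obj P₀.obj ⟶ G :=
    ObjectProperty.homMk ((restrictedYonedaIso P₀).hom ≫ g)
  have : Epi p := fpMod_epi_of_surjective _ fun Q x => by
    obtain ⟨h, hh⟩ := (hg Q).2 x
    exact ⟨(h : Q.unop ⟶ P₀).hom, hh⟩
  have hex : ∀ Q, Function.Exact (((toFPMod hd hM).map f.hom).hom.app Q) (p.hom.app Q) :=
    fun Q h => ((hg Q).1 (ObjectProperty.homMk h : Q.unop ⟶ P₀)).trans
      ⟨fun ⟨t, ht⟩ => ⟨(t : Q.unop ⟶ P₁).hom, congrArg InducedCategory.Hom.hom ht⟩,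
        fun ⟨t, ht⟩ => ⟨(ObjectProperty.homMk t : Q.unop ⟶ P₁), ObjectProperty.hom_ext _ ht⟩⟩
  have w : (toFPMod hd hM).map f.hom ≫ p = 0 := by
    apply ObjectProperty.hom_ext
    ext Q x
    exact (hex Q _).2 ⟨x, rfl⟩
  have hS : (ShortComplex.mk _ p w).Exact := (fpMod_exact_iff _).2 hex
  -- A presentation contributes two terms, and the `d`-kernel of the presenting morphism the other
  -- `d`.
  exact ⟨d + 2, ((hasResolution_kernel_map hd hM f.hom).of_kernel _ (Functor.obj_mem_essImage _ _)
    (Functor.obj_mem_essImage _ _)).of_iso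
      ((cokernelIsCokernel _).coconePointUniqueUpToIso hS.gIsCokernel)⟩

theorem isRigid_essImage [HasExt.{w} (FPMod (Proj M))] : IsRigid d (toFPMod hd hM).essImage := by
  obtain rfl | hd' := eq_or_lt_of_le hd
  · intro _ _ _ _ i hi hi'
    omega
  obtain ⟨e, rfl⟩ : ∃ e, d = e + 2 := ⟨d - 2, by omega⟩
  refine isRigid_of_hasExactResolution fun G hG => ?_
  obtain ⟨X, ⟨φ⟩⟩ := hG
  obtain ⟨S, hS, hk⟩ := hM.exists_dKernel (Projective.π X)
  -- Stated for an arbitrary `f` so that the equality of arrows can be eliminated, which is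
  -- impossible for the fixed morphism `Projective.π X`.
  have key : ∀ {A B : M} (f : A ⟶ B), Arrow.mk (S.map' (e + 2) (e + 3)) = Arrow.mk f → Epi f →
      (∀ Y : FPMod (Proj M), (toFPMod hd hM).essImage Y →
        ∀ h : kernel ((toFPMod hd hM).map f) ⟶ Y,
          ∃ g : (toFPMod hd hM).obj A ⟶ Y, kernel.ι ((toFPMod hd hM).map f) ≫ g = h) ∧
      HasExactResolution (toFPMod hd hM).essImage e (kernel ((toFPMod hd hM).map f)) := by
    intro A B f hf _
    cases hf
    have hc := (hM.isDExact_of_epi S ‹_› hk).isDCokernel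
    have hhom : ∀ (Y : FPMod (Proj M)), (toFPMod hd hM).essImage Y → ∀ (i : ℕ) (hi : i < e + 2),
        ∀ h : (toFPMod hd hM).obj (S.obj' (i + 1)) ⟶ Y,
          (toFPMod hd hM).map (S.map' i (i + 1)) ≫ h = 0 →
          ∃ h' : (toFPMod hd hM).obj (S.obj' (i + 2)) ⟶ Y,
            (toFPMod hd hM).map (S.map' (i + 1) (i + 2)) ≫ h' = h := by
      intro Y ⟨Z, ⟨ψ⟩⟩ i hi h hh
      obtain ⟨h₀, hh₀⟩ := (toFPMod hd hM).map_surjective (h ≫ ψ.inv)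
      -- Full faithfulness turns exactness of `Hom(-, F Z)` into the `d`-cokernel property in `M`.
      obtain ⟨h', hh'⟩ := (hc.exact Z i hi h₀).1 ((toFPMod hd hM).map_injective (by
        rw [Functor.map_comp, hh₀, reassoc_of% hh, zero_comp, Functor.map_zero]))
      refine ⟨(toFPMod hd hM).map h' ≫ ψ.hom, ?_⟩
      rw [← Functor.map_comp_assoc]
      change (toFPMod hd hM).map ((fun h => S.map' (i + 1) (i + 2) ≫ h) h') ≫ ψ.hom = h
      rw [hh', hh₀, Category.assoc, Iso.inv_hom_id, Category.comp_id]
    exact ⟨fun Y hY => exists_extension_kernel (hk.exact_map (hM := hM) hd) hhom e le_rfl Y hY,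
      hasExactResolution_kernel (hk.exact_map (hM := hM) hd) (prop_essImage_obj' hd hM) hhom e le_rfl⟩
  obtain ⟨h₁, h₂⟩ := key _ hS inferInstance
  have hse := shortExact_kernel ((toFPMod hd hM).map (Projective.π X))
  let p := (toFPMod hd hM).map (Projective.π X) ≫ φ.hom
  have w : kernel.ι ((toFPMod hd hM).map (Projective.π X)) ≫ p = 0 := by
    rw [← Category.assoc, kernel.condition, zero_comp]
  let ψ : ShortComplex.mk _ _ (kernel.condition ((toFPMod hd hM).map (Projective.π X))) ≅
      ShortComplex.mk _ p w :=
    ShortComplex.isoMk (Iso.refl _) (Iso.refl _) φ (by simp) (by simp [p])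
  exact ⟨_, _, _, p, w, ShortComplex.shortExact_of_iso ψ hse,
    projective_toFPMod_obj hd hM (Projective.over X), h₁, h₂⟩

end EssImage

end HigherAbelian

open HigherAbelian in
/-- Let `M` be a small projectively generated `d`-abelian category with category of projective
objects `P`, and let `F : M ⥤ mod P` be `F(X) = M(-, X)|_P`. Then `mod P`, with its pointwise
addition of morphisms, is abelian, and the essential image of `F` is `d`-cluster tilting in
`mod P`. -/
theorem theorem1p1 {M : Type u} [Category.{v} M] [Preadditive M] (d : ℕ) (hd : 1 ≤ d)
    (hM : IsDAbelian d M) [EnoughProjectives M] :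
    ∃ hA : Abelian (FPMod (Proj M)),
      hA.toPreadditive = (inferInstance : Preadditive (FPMod (Proj M))) ∧
      IsClusterTilting d (toFPMod hd hM).essImage := by
  have := hM.hasFiniteBiproducts
  have := hM.hasWeakKernels hd
  have := hasBinaryBiproducts_of_finite_biproducts (Proj M)
  -- The abelian structure is that of a full subcategory closed under kernels, cokernels and finite
  -- products, so its addition is the pointwise one by definition.
  refine ⟨inferInstance, rfl, ?_⟩
  have := HasExt.standard (FPMod (Proj M))
  exact isClusterTilting_of_isRigid (prop_essImage_zero hd hM) (prop_essImage_biprod hd hM) hd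
    (isRigid_essImage hd hM) (hasCoresolution_of_shortExact hd hM)
    (hasResolution_of_shortExact hd hM) (exists_hasResolution hd hM)
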